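/- Let $k$ be an algebraically closed field, let $n\ge 1$ be an integer that is not divisible by $\operatorname{char} k$, let $\xi\in k$ be a primitive $n$-th root of unity, and let $a$ be a natural number coprime to $n$. Let $G=\frac1n(1,a)\subseteq \mathrm{GL}(2,k)$ be the (small) cyclic group of order $n$ generated by the diagonal matrix $\operatorname{diag}(\xi,\xi^a)$, acting on $k[[u,v]]$ by linear changes of variables, and let $R=k[[u,v]]^G$ be its ring of invariants, a Noetherian local domain of dimension $2$ with residue field $k$. For $q\in\mathbb N$ put $$\mathcal S^q=\bigl(\operatorname{Sym}^q_R(\operatorname{Syz}^{2}_R(k))\bigr)^{**},$$ where $\operatorname{Syz}^2_R(k)$ is the second syzygy module of $k$ in a minimal free resolution over $R$ and $(-)^*=\operatorname{Hom}_R(-,R)$. For a finitely generated $R$-module $X$ let $\operatorname{rank}_R X$ be the dimension of $X\otimes_R \operatorname{Frac}(R)$ over $\operatorname{Frac}(R)$, and let $\operatorname{frk}_R X$ be the largest $m$ such that there is a split surjection $X\to R^m$. (1) Let $M$ be an indecomposable maximal Cohen–Macaulay $R$-module, i.e. an indecomposable finitely generated $R$-module with $\operatorname{depth}_R M=\dim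 R$. For every $q$ there is exactly one $a_q\in\mathbb N$ such that $\mathcal S^q\cong M^{a_q}\oplus N_q$ for a module $N_q$ without direct summand isomorphic to $M$, and the generalized symmetric signature of $R$ with respect to $M$ exists and is $$s_\sigma(R,M)=\lim_{N\to\infty}\frac{\sum_{q=0}^N a_q}{\sum_{q=0}^N\operatorname{rank}_R\mathcal S^q}=\frac1{|G|}.$$ (2) The symmetric signature of $R$ exists and is $$s_\sigma(R)=\lim_{N\to\infty}\frac{\sum_{q=0}^N\operatorname{frk}_R\mathcal S^q}{\sum_{q=0}^N\operatorname{rank}_R\mathcal S^q}=\frac1{|G|}.$$ -/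

import Mathlib

open Filter Topology

universe u v w

noncomputable section

namespace SymmetricSignature

/-! ### Modules over commutative and local rings -/

section Modules

variable (R : Type u) [CommRing R]

/-- The rank of a module over a domain: the dimension of its localization at all nonzero elements,
as a vector space over the fraction field. -/
def rank [IsDomain R] (M : Type v) [AddCommGroup M] [Module R M] : ℕ :=
  Module.finrank (FractionRing R) (LocalizedModule (nonZeroDivisors R) M)

/-- The free rank of a (finitely generated) module `M`: the largest `n` such that there is a split
surjection `M → Rⁿ`. -/
def freeRank (M : Type v) [AddCommGroup M] [Module R M] : ℕ :=
  sSup {n : ℕ | ∃ (φ : M →ₗ[R] (Fin n → R)) (ψ : (Fin n → R) →ₗ[R] M), φ ∘ₗ ψ = LinearMap.id}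

/-- A nonzero module is indecomposable if in each decomposition as an (internal) direct sum of two
submodules one of them is zero. -/
def IsIndecomposable (M : Type v) [AddCommGroup M] [Module R M] : Prop :=
  Nontrivial M ∧ ∀ A B : Submodule R M, IsCompl A B → A = ⊥ ∨ B = ⊥

/-- `X` has a direct summand isomorphic to `M`. -/
def HasSummand (M : Type v) [AddCommGroup M] [Module R M]
    (X : Type w) [AddCommGroup X] [Module R X] : Prop :=
  ∃ P N : Submodule R X, IsCompl P N ∧ Nonempty (P ≃ₗ[R] M)

/-- `X = Mᵃ ⊕ N`, where `N` has no direct summand isomorphic to `M`. -/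
def IsMultiplicity (M : Type v) [AddCommGroup M] [Module R M]
    (X : Type w) [AddCommGroup X] [Module R X] (a : ℕ) : Prop :=
  ∃ P N : Submodule R X, IsCompl P N ∧ Nonempty (P ≃ₗ[R] (Fin a → M)) ∧ ¬ HasSummand R M N

/-- The depth of a module over a local ring: the supremum of the lengths of the `M`-regular
sequences in the maximal ideal. -/
def depth [IsLocalRing R] (M : Type v) [AddCommGroup M] [Module R M] : ℕ∞ :=
  ⨆ rs ∈ {rs : List R | (∀ r ∈ rs, r ∈ IsLocalRing.maximalIdeal R) ∧
    RingTheory.Sequence.IsRegular M rs}, (rs.length : ℕ∞)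

/-- Maximal Cohen-Macaulay modules: finitely generated modules with `depth M = dim R`. -/
def IsMCM [IsLocalRing R] (M : Type v) [AddCommGroup M] [Module R M] : Prop :=
  Module.Finite R M ∧ (depth R M : WithBot ℕ∞) = ringKrullDim R

/-- The map from the free module on a minimal system of generators of `M` onto `M`
(`Submodule.generators` is a generating set of the least possible cardinality). -/
def minimalCover (M : Type v) [AddCommGroup M] [Module R M] :
    ((⊤ : Submodule R M).generators →₀ R) →ₗ[R] M :=
  Finsupp.linearCombination R Subtype.val

/-- The `n`-th syzygy module of `M` in the minimal free resolution of `M`, which is built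
step by step by covering the previous syzygy by the free module on a minimal system of
generators. -/
def syzygy : ℕ → ModuleCat.{u} R → ModuleCat.{u} R
  | 0, M => M
  | n + 1, M => ModuleCat.of R (LinearMap.ker (minimalCover R (syzygy n M)))

/-- The `q`-th reflexive symmetric power `(Sym^q M)^{**}`. -/
abbrev ReflexiveSymmetricPower (q : ℕ) (M : Type v) [AddCommGroup M] [Module R M] :
    Type (max u v) :=
  Module.Dual R (Module.Dual R (SymmetricPower R (ULift.{u} (Fin q)) M))

end Modules

/-! ### The symmetric signature of a Noetherian local domain -/

section Signature

variable (R : Type u) [CommRing R] [IsDomain R] [IsLocalRing R]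

/-- The Krull dimension of a Noetherian local ring, as a natural number. -/
def dim : ℕ := ((ringKrullDim R).unbotD 0).toNat

/-- `𝒮^q = (Sym^q(Syz^d(k)))^{**}`, where `k` is the residue field and `d` the dimension
of `R`. -/
abbrev SymSyz (q : ℕ) : Type u :=
  ReflexiveSymmetricPower R q
    (syzygy R (dim R) (ModuleCat.of R (IsLocalRing.ResidueField R)))

/-- The symmetric signature of `R` exists and is equal to `s`. -/
def HasSymmetricSignature (s : ℝ) : Prop :=
  Tendsto (fun N : ℕ =>
      (∑ q ∈ Finset.range (N + 1), (freeRank R (SymSyz R q) : ℝ)) /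
        ∑ q ∈ Finset.range (N + 1), (rank R (SymSyz R q) : ℝ))
    atTop (𝓝 s)

/-- The generalized symmetric signature of `R` with respect to `M` exists and is equal to `s`:
the multiplicities `a q` of `M` in the modules `𝒮^q` are well defined, and the limit of the
quotients of the sums of the multiplicities and of the ranks is `s`. -/
def HasGeneralizedSymmetricSignature (M : Type v) [AddCommGroup M] [Module R M] (s : ℝ) : Prop :=
  ∃ a : ℕ → ℕ, (∀ q b, IsMultiplicity R M (SymSyz R q) b ↔ b = a q) ∧
    Tendsto (fun N : ℕ =>
        (∑ q ∈ Finset.range (N + 1), (a q : ℝ)) /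
          ∑ q ∈ Finset.range (N + 1), (rank R (SymSyz R q) : ℝ))
      atTop (𝓝 s)

end Signature

/-! ### Invariant rings of linear groups and the groups `(1/n)(1,a)` -/

section Invariants

variable {k : Type u} [Field k]

theorem hasSubst_linear (g : GL (Fin 2) k) :
    MvPowerSeries.HasSubst
      (fun j => ∑ i, g i j • (MvPowerSeries.X i : MvPowerSeries (Fin 2) k)) :=
  MvPowerSeries.hasSubst_of_constantCoeff_zero fun j => by simp

/-- The action of a matrix `g` on `k[[x₀, x₁]]` by the linear change of variables
`x_j ↦ ∑ i, g i j x_i`. -/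
def linearAction (g : GL (Fin 2) k) :
    MvPowerSeries (Fin 2) k →ₐ[k] MvPowerSeries (Fin 2) k :=
  MvPowerSeries.substAlgHom (hasSubst_linear g)

/-- The invariant ring `k[[x₀, x₁]]^G`. -/
def invariantRing (G : Subgroup (GL (Fin 2) k)) : Subalgebra k (MvPowerSeries (Fin 2) k) where
  carrier := {f | ∀ g ∈ G, linearAction g f = f}
  mul_mem' hx hy g hg := by rw [map_mul, hx g hg, hy g hg]
  add_mem' hx hy g hg := by rw [map_add, hx g hg, hy g hg]
  algebraMap_mem' r g _ := AlgHom.commutes _ r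

instance (G : Subgroup (GL (Fin 2) k)) : IsDomain (invariantRing G) :=
  have : IsDomain (MvPowerSeries (Fin 2) k) := NoZeroDivisors.to_isDomain _
  inferInstance

instance (G : Subgroup (GL (Fin 2) k)) : IsLocalRing (invariantRing G) := by
  have key : ∀ x : invariantRing G, IsUnit (x : MvPowerSeries (Fin 2) k) → IsUnit x := by
    rintro ⟨x, hx⟩ hu
    obtain ⟨y, hy⟩ := hu.exists_right_inv
    have hmem : y ∈ invariantRing G := fun g hg => by
      have h1 : x * linearAction g y = 1 := by
        rw [← map_one (linearAction g), ← hy, map_mul, hx g hg]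
      exact mul_left_cancel₀ hu.ne_zero (h1.trans hy.symm)
    exact IsUnit.of_mul_eq_one ⟨y, hmem⟩ (Subtype.ext hy)
  refine IsLocalRing.of_isUnit_or_isUnit_one_sub_self fun x => ?_
  rcases IsLocalRing.isUnit_or_isUnit_one_sub_self (x : MvPowerSeries (Fin 2) k) with h | h
  · exact Or.inl (key x h)
  · exact Or.inr (key (1 - x) h)

/-- The diagonal matrix with entries `ξ`, `ξ ^ a`. -/
def diagGenerator (ξ : kˣ) (a : ℕ) : GL (Fin 2) k :=
  Matrix.GeneralLinearGroup.mkOfDetNeZero (Matrix.diagonal ![(ξ : k), (ξ : k) ^ a])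
    (by simp [Matrix.det_diagonal])

/-- The cyclic subgroup of `GL(2, k)` generated by the diagonal matrix with entries `ξ`, `ξ ^ a`.
If `ξ` is a primitive `n`-th root of unity, this is the group `(1/n)(1,a)`. -/
def cyclicGroup (ξ : kˣ) (a : ℕ) : Subgroup (GL (Fin 2) k) :=
  Subgroup.zpowers (diagGenerator ξ a)

/-- The cyclic quotient singularity `k[[u, v]]^G` for the group `G = (1/n)(1,a)` attached to a
primitive `n`-th root of unity `ξ`. -/
abbrev cyclicSingularity (ξ : kˣ) (a : ℕ) : Subalgebra k (MvPowerSeries (Fin 2) k) :=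
  invariantRing (cyclicGroup ξ a)

end Invariants

end SymmetricSignature

end

noncomputable section

namespace SymmetricSignature

open MvPowerSeries

/-! ### Divisibility in `k[[u, v]]` -/

section PowerSeries

variable {k : Type u} [Field k]

/-! Write S = k[[u,v]]. Giving uⁱvʲ the weight i + aj in ℤ/n grades S, and since ξ is a primitive
n-th root of unity the invariant ring R is the part S_0 (`cyclicSingularity_eq_weightRing`). All
modules involved turn out to be direct sums of the rank one R-modules S_χ (`weightPart`), so the
signature becomes a count of weights.

The pieces S_χ are rigid: an R-multilinear map from a finite product of them to S is (s_i) ↦ (∏ s_i)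
h for a single h in S (`exists_multilinearMap_eq`). The reason is that each S_χ contains both a
power of u and a power of v; the latter needs a coprime to n. Hence every endomorphism of S_χ is
multiplication by an element of the local ring R, the multiplicity of S_ψ in a finite direct sum of
pieces is well defined (`isMultiplicity_iff`), and the reflexive q-th symmetric power of ⊕ S_{χ_t}
is the sum of the pieces S_{χ_{t_1}+...+χ_{t_q}} over all multisets {t_1,...,t_q}
(`reflexiveSymmetricPower_equiv`).

Decompositions into pieces come from S: a finitely generated graded S-module of depth two has a
homogeneous basis (`exists_homogeneous_basis`), so its part of degree zero is a sum of pieces.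
Applied to Hom_R(S,M), whose part of degree zero is M, this shows that an indecomposable maximal
Cohen–Macaulay module is some S_χ. Applied to the relations over S between generators of the maximal
ideal of R, it decomposes Syz²(k). A Koszul-like relation of degree a is not in (u,v) times the
relations (`exists_relation`), so S_{-a} occurs, and -a is a unit of ℤ/n.

Thus a_q counts the multisets of size q with total weight ψ, and the rank counts all of them.
Adjoining an element of unit weight χ maps size q and weight ψ injectively to size q+1 and weight
ψ+χ. This forces the partial sums up to N for any two weights to differ by at most n times the
number of multisets of size N, which is negligible against the total (`tendsto_sum_div_sum`). Each
of the n weights therefore receives the proportion 1/n. -/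

theorem X_pow_dvd_of_dvd_X_pow_mul {s t : Fin 2} (hst : s ≠ t) {i j : ℕ}
    {f : MvPowerSeries (Fin 2) k} (h : X s ^ i ∣ X t ^ j * f) : X s ^ i ∣ f := by
  classical
  rw [X_pow_dvd_iff] at h ⊢
  intro m hm
  have := h (Finsupp.single t j + m) (by simpa [Finsupp.single_apply, hst.symm] using hm)
  rwa [X_pow_eq, coeff_add_monomial_mul, one_mul] at this

/-- The monomials without u form a power series in v of order at least i. When i is exactly that
order, w is a unit: a weak form of Weierstrass preparation. -/
theorem exists_eq_X_mul_add_X_pow_mul (i : ℕ) (f : MvPowerSeries (Fin 2) k)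
    (h : ∀ j < i, coeff (Finsupp.single 1 j) f = 0) :
    ∃ g w : MvPowerSeries (Fin 2) k, f = X 0 * g + X 1 ^ i * w ∧
      constantCoeff w = coeff (Finsupp.single 1 i) f := by
  classical
  let f₀ : MvPowerSeries (Fin 2) k := fun d => if d 0 = 0 then coeff d f else 0
  have hf₀ : ∀ d, coeff d f₀ = if d 0 = 0 then coeff d f else 0 := fun d => rfl
  have hs : ∀ d : Fin 2 →₀ ℕ, d 0 = 0 → d = Finsupp.single 1 (d 1) := by
    intro d hd
    ext l
    fin_cases l <;> simp [hd]
  obtain ⟨g, hg⟩ : X 0 ∣ f - f₀ := by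
    rw [X_dvd_iff]
    intro d hd
    simp [hf₀, hd]
  obtain ⟨w, hw⟩ : X 1 ^ i ∣ f₀ := by
    rw [X_pow_dvd_iff]
    intro d hd
    rw [hf₀]
    split_ifs with h0
    · rw [hs d h0]; exact h _ hd
    · rfl
  refine ⟨g, w, by rw [← hg, ← hw]; ring, ?_⟩
  have h1 := hf₀ (Finsupp.single 1 i)
  rw [hw, X_pow_eq] at h1
  have h2 := coeff_add_monomial_mul (Finsupp.single 1 i) 0 w (1 : k)
  rw [add_zero, h1, one_mul] at h2
  simpa using h2.symm

theorem exists_eq_X_mul_add_X_mul {f : MvPowerSeries (Fin 2) k} (h : constantCoeff f = 0) :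
    ∃ g w : MvPowerSeries (Fin 2) k, f = X 0 * g + X 1 * w := by
  obtain ⟨g, w, h, -⟩ := exists_eq_X_mul_add_X_pow_mul 1 f (by
    intro j hj
    obtain rfl : j = 0 := by omega
    simpa using h)
  exact ⟨g, w, by simpa using h⟩

/-- Modulo u, the series x is a unit times vⁱ while y is a multiple of v, so x divides yⁱ modulo u.
-/
theorem exists_pow_eq_mul_add_X_mul {x y : MvPowerSeries (Fin 2) k}
    (hy : constantCoeff y = 0) (hx : ¬ X 0 ∣ x) :
    ∃ (i : ℕ) (c d : MvPowerSeries (Fin 2) k), y ^ i = x * c + X 0 * d := by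
  classical
  have hex : ∃ i, coeff (Finsupp.single 1 i) x ≠ 0 := by
    by_contra! h
    refine hx (X_dvd_iff.2 fun d hd => ?_)
    have : d = Finsupp.single 1 (d 1) := by
      ext l
      fin_cases l <;> simp [hd]
    rw [this]; exact h _
  obtain ⟨g, w, hgw, hw⟩ := exists_eq_X_mul_add_X_pow_mul (Nat.find hex) x
    fun j hj => not_not.1 (Nat.find_min hex hj)
  obtain ⟨w', hw'⟩ := (isUnit_iff_constantCoeff.2
    (isUnit_iff_ne_zero.2 (hw ▸ Nat.find_spec hex))).exists_right_inv
  obtain ⟨p, q, rfl⟩ := exists_eq_X_mul_add_X_mul hy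
  obtain ⟨r, hr⟩ : X 0 ∣ (X 0 * p + X 1 * q) ^ Nat.find hex - (X 1 * q) ^ Nat.find hex :=
    dvd_trans ⟨p, by ring⟩ (sub_dvd_pow_sub_pow _ _ _)
  refine ⟨Nat.find hex, w' * q ^ Nat.find hex, r - g * w' * q ^ Nat.find hex, ?_⟩
  rw [sub_eq_iff_eq_add] at hr
  rw [hr]
  linear_combination (-(X 1 * q) ^ Nat.find hex) * hw' - w' * q ^ Nat.find hex * hgw

end PowerSeries

/-! ### The grading of `k[[u, v]]` by weights -/

section Weights

variable (k : Type u) [Field k] (n a : ℕ)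

/-- The weight of the monomial `uⁱvʲ` with respect to the action of type `(1/n)(1,a)`. -/
def weight : (Fin 2 →₀ ℕ) →+ ZMod n where
  toFun d := d 0 + a * d 1
  map_zero' := by simp
  map_add' d e := by simp; ring

theorem weight_apply (d : Fin 2 →₀ ℕ) : weight n a d = d 0 + a * d 1 := rfl

variable {n a} in
theorem weight_add_eq_of_coeff_mul_ne_zero {f g : MvPowerSeries (Fin 2) k} {χ ψ : ZMod n}
    (hf : ∀ d, coeff d f ≠ 0 → weight n a d = χ) (hg : ∀ d, coeff d g ≠ 0 → weight n a d = ψ)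
    {d : Fin 2 →₀ ℕ} (hd : coeff d (f * g) ≠ 0) : weight n a d = χ + ψ := by
  classical
  rw [coeff_mul] at hd
  obtain ⟨p, hp, hne⟩ := Finset.exists_ne_zero_of_sum_ne_zero hd
  rw [← Finset.HasAntidiagonal.mem_antidiagonal.1 hp, map_add, hf _ (left_ne_zero_of_mul hne),
    hg _ (right_ne_zero_of_mul hne)]

/-- The power series all of whose monomials have weight zero. -/
def weightRing : Subalgebra k (MvPowerSeries (Fin 2) k) where
  carrier := {f | ∀ d, coeff d f ≠ 0 → weight n a d = 0}
  mul_mem' hf hg d hd := by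
    rw [weight_add_eq_of_coeff_mul_ne_zero k hf hg hd, add_zero]
  add_mem' {f g} hf hg d hd := by
    by_contra h
    exact hd (by rw [map_add, not_not.1 (mt (hf d) h), not_not.1 (mt (hg d) h), add_zero])
  algebraMap_mem' r d hd := by
    classical
    rw [MvPowerSeries.algebraMap_apply, Algebra.algebraMap_self, RingHom.id_apply, coeff_C] at hd
    obtain rfl : d = 0 := by by_contra h; simp [h] at hd
    exact map_zero _

/-- The power series all of whose monomials have weight `χ`, as a module over those of weight
zero. -/
def weightPart (χ : ZMod n) : Submodule (weightRing k n a) (MvPowerSeries (Fin 2) k) where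
  carrier := {f | ∀ d, coeff d f ≠ 0 → weight n a d = χ}
  zero_mem' d hd := absurd (map_zero _) hd
  add_mem' {f g} hf hg d hd := by
    by_contra h
    exact hd (by rw [map_add, not_not.1 (mt (hf d) h), not_not.1 (mt (hg d) h), add_zero])
  smul_mem' r f hf d hd := by
    rw [weight_add_eq_of_coeff_mul_ne_zero k r.2 hf hd, zero_add]

variable {k n a}

theorem mem_weightRing {f : MvPowerSeries (Fin 2) k} :
    f ∈ weightRing k n a ↔ f ∈ weightPart k n a 0 := Iff.rfl

theorem mul_mem_weightPart {χ ψ : ZMod n} {f g : MvPowerSeries (Fin 2) k}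
    (hf : f ∈ weightPart k n a χ) (hg : g ∈ weightPart k n a ψ) :
    f * g ∈ weightPart k n a (χ + ψ) :=
  fun _ => weight_add_eq_of_coeff_mul_ne_zero k hf hg

theorem one_mem_weightPart : (1 : MvPowerSeries (Fin 2) k) ∈ weightPart k n a 0 :=
  mem_weightRing.1 (one_mem _)

theorem prod_mem_weightPart {ι : Type*} (s : Finset ι) {χ : ι → ZMod n}
    {f : ι → MvPowerSeries (Fin 2) k} (hf : ∀ i ∈ s, f i ∈ weightPart k n a (χ i)) :
    ∏ i ∈ s, f i ∈ weightPart k n a (∑ i ∈ s, χ i) := by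
  classical
  induction s using Finset.induction_on with
  | empty => simpa using one_mem_weightPart
  | insert i s hi ih =>
    rw [Finset.prod_insert hi, Finset.sum_insert hi]
    exact mul_mem_weightPart (hf i (s.mem_insert_self i))
      (ih fun j hj => hf j (Finset.mem_insert_of_mem hj))

theorem pow_mem_weightPart {χ : ZMod n} {f : MvPowerSeries (Fin 2) k}
    (hf : f ∈ weightPart k n a χ) (i : ℕ) : f ^ i ∈ weightPart k n a (i * χ) := by
  simpa using prod_mem_weightPart (Finset.range i) (fun _ _ => hf)

theorem X_zero_mem_weightPart : (X 0 : MvPowerSeries (Fin 2) k) ∈ weightPart k n a 1 := by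
  classical
  intro d hd
  obtain rfl : d = Finsupp.single 0 1 := by by_contra h; simp [coeff_X, h] at hd
  simp [weight_apply]

theorem X_one_mem_weightPart : (X 1 : MvPowerSeries (Fin 2) k) ∈ weightPart k n a a := by
  classical
  intro d hd
  obtain rfl : d = Finsupp.single 1 1 := by by_contra h; simp [coeff_X, h] at hd
  simp [weight_apply]

theorem mem_weightPart_of_mul_mem {χ ψ : ZMod n} {g : MvPowerSeries (Fin 2) k} {s : Fin 2} {i : ℕ}
    (hs : X s ^ i ∈ weightPart k n a χ) (h : X s ^ i * g ∈ weightPart k n a (χ + ψ)) :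
    g ∈ weightPart k n a ψ := by
  classical
  intro d hd
  have h1 : weight n a (Finsupp.single s i) = χ :=
    hs _ (by rw [X_pow_eq]; simp)
  have h2 := h (Finsupp.single s i + d) (by rwa [X_pow_eq, coeff_add_monomial_mul, one_mul])
  rw [map_add, h1] at h2
  exact add_left_cancel h2

theorem constantCoeff_eq_zero_of_mem_weightPart {χ : ZMod n} (hχ : χ ≠ 0)
    {f : MvPowerSeries (Fin 2) k} (hf : f ∈ weightPart k n a χ) : constantCoeff f = 0 := by
  by_contra h
  exact hχ (by simpa using (hf 0 (by simpa using h)).symm)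

variable (k n a) in
/-- The projection onto the power series of weight `χ`. -/
def weightProj (χ : ZMod n) : MvPowerSeries (Fin 2) k →+ MvPowerSeries (Fin 2) k where
  toFun f := fun d => if weight n a d = χ then coeff d f else 0
  map_zero' := by
    ext d
    change (if weight n a d = χ then coeff d (0 : MvPowerSeries (Fin 2) k) else 0) = 0
    simp
  map_add' f g := by
    ext d
    change (if weight n a d = χ then coeff d (f + g) else 0) =
      (if weight n a d = χ then coeff d f else 0) + if weight n a d = χ then coeff d g else 0
    split_ifs <;> simp

theorem coeff_weightProj (χ : ZMod n) (f : MvPowerSeries (Fin 2) k) (d : Fin 2 →₀ ℕ) :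
    coeff d (weightProj k n a χ f) = if weight n a d = χ then coeff d f else 0 := rfl

theorem weightProj_mem (χ : ZMod n) (f : MvPowerSeries (Fin 2) k) :
    weightProj k n a χ f ∈ weightPart k n a χ := by
  intro d hd
  by_contra h
  simp [coeff_weightProj, h] at hd

theorem weightProj_of_mem {χ : ZMod n} {f : MvPowerSeries (Fin 2) k}
    (hf : f ∈ weightPart k n a χ) : weightProj k n a χ f = f := by
  ext d
  rw [coeff_weightProj]
  split_ifs with h
  · rfl
  · exact (not_not.1 (mt (hf d) h)).symm

theorem weightProj_of_mem_of_ne {χ ψ : ZMod n} (hne : χ ≠ ψ) {f : MvPowerSeries (Fin 2) k}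
    (hf : f ∈ weightPart k n a ψ) : weightProj k n a χ f = 0 := by
  ext d
  rw [coeff_weightProj, map_zero]
  split_ifs with h
  · exact not_not.1 (mt (hf d) (h ▸ hne))
  · rfl

theorem sum_weightProj [NeZero n] (f : MvPowerSeries (Fin 2) k) :
    ∑ χ, weightProj k n a χ f = f := by
  ext d
  simp [coeff_weightProj]

theorem weightProj_mul {χ ψ : ZMod n} {s : MvPowerSeries (Fin 2) k}
    (hs : s ∈ weightPart k n a χ) (f : MvPowerSeries (Fin 2) k) :
    weightProj k n a (χ + ψ) (s * f) = s * weightProj k n a ψ f := by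
  classical
  ext d
  rw [coeff_weightProj, coeff_mul, coeff_mul]
  have key : ∀ p ∈ Finset.HasAntidiagonal.antidiagonal d,
      coeff p.1 s * coeff p.2 (weightProj k n a ψ f) =
      if weight n a d = χ + ψ then coeff p.1 s * coeff p.2 f else 0 := by
    intro p hp
    rw [coeff_weightProj, ← Finset.HasAntidiagonal.mem_antidiagonal.1 hp, map_add]
    by_cases h : coeff p.1 s = 0
    · simp [h]
    · simp [hs _ h]
  rw [Finset.sum_congr rfl key]
  split_ifs <;> simp

end Weights

/-! ### Graded modules of depth two over `k[[u, v]]` are free -/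

section GradedModules

variable {k : Type u} [Field k]

/-- Iterating the hypothesis puts every entry of every member of C into all powers of (u,v), whose
intersection is zero. C need not be a submodule, so the argument is by orders of vanishing. -/
theorem eq_zero_of_forall_relation {ι : Type*} (C : Set (ι → MvPowerSeries (Fin 2) k))
    (hC : ∀ c ∈ C, ∃ p ∈ C, ∃ q ∈ C, ∀ i, c i = X 0 * p i + X 1 * q i) :
    ∀ c ∈ C, ∀ i, c i = 0 := by
  classical
  have hX : ∀ (s : Fin 2) (j : ℕ) (f : MvPowerSeries (Fin 2) k),
      (∀ d : Fin 2 →₀ ℕ, d.degree < j → coeff d f = 0) →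
      ∀ d : Fin 2 →₀ ℕ, d.degree < j + 1 → coeff d (X s * f) = 0 := by
    intro s j f hf d hd
    by_cases hs : d s = 0
    · exact X_dvd_iff.1 (dvd_mul_right _ _) d hs
    · obtain ⟨e, rfl⟩ : ∃ e, d = Finsupp.single s 1 + e :=
        ⟨d - Finsupp.single s 1, by
          rw [add_tsub_cancel_of_le]
          simpa using Nat.one_le_iff_ne_zero.2 hs⟩
      rw [X_def, coeff_add_monomial_mul, one_mul]
      apply hf
      simp at hd
      omega
  have key : ∀ j : ℕ, ∀ c ∈ C, ∀ i, ∀ d : Fin 2 →₀ ℕ, d.degree < j → coeff d (c i) = 0 := by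
    intro j
    induction j with
    | zero => intro c _ i d hd; omega
    | succ j ih =>
      intro c hc i d hd
      obtain ⟨p, hp, q, hq, h⟩ := hC c hc
      rw [h i, map_add, hX 0 j _ (ih p hp i) d hd, hX 1 j _ (ih q hq i) d hd, add_zero]
  intro c hc i
  ext d
  exact key (d.degree + 1) c hc i d (Nat.lt_succ_self _)

/-- By `hmin` a relation c has the form up + vq. Depth two makes ∑ qᵢeᵢ divisible by u, and a Koszul
correction then turns p and q into relations themselves. So the relations R satisfy R ⊆ uR + vR and
vanish. -/
theorem linearIndependent_of_depth_two {N ι : Type*} [AddCommGroup N]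
    [Module (MvPowerSeries (Fin 2) k) N] [Fintype ι] {e : ι → N}
    (hu : ∀ x : N, (X 0 : MvPowerSeries (Fin 2) k) • x = 0 → x = 0)
    (huv : ∀ x y : N, (X 1 : MvPowerSeries (Fin 2) k) • x = (X 0 : MvPowerSeries (Fin 2) k) • y →
      ∃ z, x = (X 0 : MvPowerSeries (Fin 2) k) • z)
    (hspan : ∀ x, ∃ c : ι → MvPowerSeries (Fin 2) k, ∑ i, c i • e i = x)
    (hmin : ∀ c : ι → MvPowerSeries (Fin 2) k, ∑ i, c i • e i = 0 →
      ∀ i, constantCoeff (c i) = 0) :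
    LinearIndependent (MvPowerSeries (Fin 2) k) e := by
  rw [Fintype.linearIndependent_iff]
  refine eq_zero_of_forall_relation {c | ∑ i, c i • e i = 0} fun c hc => ?_
  choose p q hpq using fun i => exists_eq_X_mul_add_X_mul (hmin c hc i)
  have h1 : (X 0 : MvPowerSeries (Fin 2) k) • ∑ i, p i • e i +
      (X 1 : MvPowerSeries (Fin 2) k) • ∑ i, q i • e i = 0 := by
    rw [Set.mem_ofPred_eq] at hc
    rw [← hc, Finset.smul_sum, Finset.smul_sum, ← Finset.sum_add_distrib]
    refine Finset.sum_congr rfl fun i _ => ?_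
    rw [hpq i, add_smul, mul_smul, mul_smul]
  obtain ⟨z, hz⟩ := huv (∑ i, q i • e i) (-∑ i, p i • e i) (by
    rw [smul_neg]; exact (neg_eq_of_add_eq_zero_right h1).symm)
  obtain ⟨c', rfl⟩ := hspan z
  -- Adding (v c', -u c') to (p, q) does not change up + vq.
  refine ⟨fun i => p i + X 1 * c' i, ?_, fun i => q i - X 0 * c' i, ?_, fun i => ?_⟩
  · apply hu
    simp only [add_smul, mul_smul, Finset.sum_add_distrib, ← Finset.smul_sum]
    rw [hz] at h1
    rw [smul_add, smul_comm (X 0 : MvPowerSeries (Fin 2) k) (X 1), h1]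
  · simp only [Set.mem_ofPred_eq, sub_smul, mul_smul, Finset.sum_sub_distrib, ← Finset.smul_sum]
    rw [hz, sub_self]
  · rw [hpq i]; ring

variable (k) (n a : ℕ) [NeZero n]

/-- A grading of a module over `k[[u, v]]` that is compatible with the grading by weights, given by
the projections onto the homogeneous parts. -/
structure WeightGrading (N : Type*) [AddCommGroup N] [Module (MvPowerSeries (Fin 2) k) N] where
  proj : ZMod n → N →+ N
  sum_proj : ∀ x, ∑ χ, proj χ x = x
  proj_proj : ∀ χ x, proj χ (proj χ x) = proj χ x
  proj_proj_of_ne : ∀ χ ψ, χ ≠ ψ → ∀ x, proj χ (proj ψ x) = 0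
  proj_smul : ∀ (χ ψ : ZMod n) (s : MvPowerSeries (Fin 2) k), s ∈ weightPart k n a χ →
    ∀ x, proj (χ + ψ) (s • x) = s • proj ψ x

namespace WeightGrading

variable {k n a} {N : Type*} [AddCommGroup N] [Module (MvPowerSeries (Fin 2) k) N]
  (𝒢 : WeightGrading k n a N)

theorem proj_smul_of_homogeneous {d : ZMod n} {e : N} (he : 𝒢.proj d e = e) (χ : ZMod n)
    (s : MvPowerSeries (Fin 2) k) :
    𝒢.proj χ (s • e) = weightProj k n a (χ - d) s • e := by
  conv_lhs => rw [← sum_weightProj (n := n) (a := a) s, Finset.sum_smul, map_sum]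
  rw [Finset.sum_eq_single (χ - d)]
  · have := 𝒢.proj_smul (χ - d) d _ (weightProj_mem (χ - d) s) e
    rwa [sub_add_cancel, he] at this
  · intro ψ _ hψ
    have := 𝒢.proj_smul ψ (χ - ψ) _ (weightProj_mem ψ s) e
    rw [add_sub_cancel] at this
    rw [this, ← he, 𝒢.proj_proj_of_ne, smul_zero]
    rintro rfl
    exact hψ (by ring)
  · simp

theorem exists_homogeneous_generators [Module.Finite (MvPowerSeries (Fin 2) k) N] :
    ∃ (r : ℕ) (e : Fin r → N) (d : Fin r → ZMod n), (∀ t, 𝒢.proj (d t) (e t) = e t) ∧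
      Submodule.span (MvPowerSeries (Fin 2) k) (Set.range e) = ⊤ := by
  classical
  obtain ⟨s, hs⟩ := Module.Finite.fg_top (R := MvPowerSeries (Fin 2) k) (M := N)
  let φ := (Fintype.equivFin (s × ZMod n)).symm
  refine ⟨_, fun t => 𝒢.proj (φ t).2 (φ t).1, fun t => (φ t).2, fun t => 𝒢.proj_proj _ _, ?_⟩
  rw [eq_top_iff, ← hs, Submodule.span_le]
  intro x hx
  rw [← 𝒢.sum_proj x]
  refine sum_mem fun χ _ => Submodule.subset_span ⟨φ.symm (⟨x, hx⟩, χ), by simp⟩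

/-- A homogeneous generating family of least size is a basis: a relation with a unit coefficient
would make one generator redundant, and the others are still homogeneous. So all coefficients of
relations lie in the maximal ideal and the depth criterion applies. -/
theorem exists_homogeneous_basis [Module.Finite (MvPowerSeries (Fin 2) k) N]
    (hu : ∀ x : N, (X 0 : MvPowerSeries (Fin 2) k) • x = 0 → x = 0)
    (huv : ∀ x y : N, (X 1 : MvPowerSeries (Fin 2) k) • x = (X 0 : MvPowerSeries (Fin 2) k) • y →
      ∃ z, x = (X 0 : MvPowerSeries (Fin 2) k) • z) :
    ∃ (r : ℕ) (e : Module.Basis (Fin r) (MvPowerSeries (Fin 2) k) N) (d : Fin r → ZMod n),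
      ∀ t, 𝒢.proj (d t) (e t) = e t := by
  classical
  have hex := 𝒢.exists_homogeneous_generators
  obtain ⟨e, d, hd, he⟩ := Nat.find_spec hex
  have hspan : ∀ x, ∃ c : Fin (Nat.find hex) → MvPowerSeries (Fin 2) k, ∑ i, c i • e i = x :=
    fun x => Submodule.mem_span_range_iff_exists_fun _ |>.1 (he.ge Submodule.mem_top)
  refine ⟨_, Module.Basis.mk (linearIndependent_of_depth_two hu huv hspan ?_) he.ge, d,
    fun t => by simpa using hd t⟩
  intro c hc i
  by_contra hi
  obtain ⟨w, hw⟩ := (isUnit_iff_constantCoeff.2 (isUnit_iff_ne_zero.2 hi)).exists_left_inv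
  obtain ⟨r, hr⟩ : ∃ r, Nat.find hex = r + 1 := ⟨_, (Nat.succ_pred_eq_of_pos i.pos).symm⟩
  refine Nat.find_min hex (m := r) (by omega) ?_
  clear hspan
  generalize Nat.find hex = r' at *
  subst hr
  refine ⟨e ∘ i.succAbove, d ∘ i.succAbove, fun t => hd _, ?_⟩
  rw [eq_top_iff, ← he, Submodule.span_le]
  rintro _ ⟨j, rfl⟩
  rcases Fin.eq_self_or_eq_succAbove i j with rfl | ⟨j, rfl⟩
  · rw [Fin.sum_univ_succAbove _ j] at hc
    have h1 : e j = -w • ∑ t, c (j.succAbove t) • e (j.succAbove t) := by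
      rw [← neg_eq_of_add_eq_zero_right hc, smul_neg, neg_smul, neg_neg, smul_smul, hw, one_smul]
    rw [h1]
    exact Submodule.smul_mem _ _ (sum_mem fun t _ =>
      Submodule.smul_mem _ _ (Submodule.subset_span ⟨t, rfl⟩))
  · exact Submodule.subset_span ⟨j, rfl⟩

/-- The elements of degree `0`. -/
def zeroPart : Submodule (weightRing k n a) N where
  carrier := {x | 𝒢.proj 0 x = x}
  zero_mem' := map_zero _
  add_mem' {x y} hx hy := by
    rw [Set.mem_ofPred_eq] at *
    rw [map_add, hx, hy]
  smul_mem' r x hx := by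
    rw [Set.mem_ofPred_eq] at *
    have := 𝒢.proj_smul 0 0 r r.2 x
    rw [hx, zero_add] at this
    exact this

theorem mem_zeroPart {x : N} : x ∈ 𝒢.zeroPart ↔ 𝒢.proj 0 x = x := Iff.rfl

/-- The part of degree zero of a graded free module. -/
def zeroPartEquiv {r : ℕ} (e : Module.Basis (Fin r) (MvPowerSeries (Fin 2) k) N)
    {d : Fin r → ZMod n} (he : ∀ t, 𝒢.proj (d t) (e t) = e t) :
    (∀ t, weightPart k n a (-d t)) ≃ₗ[weightRing k n a] 𝒢.zeroPart :=
  LinearEquiv.ofBijective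
    ({ toFun s := ⟨∑ t, (s t : MvPowerSeries (Fin 2) k) • e t, by
          rw [mem_zeroPart, map_sum]
          refine Finset.sum_congr rfl fun t _ => ?_
          rw [𝒢.proj_smul_of_homogeneous (he t), zero_sub, weightProj_of_mem (s t).2]⟩
       map_add' s s' := by
          ext
          simp [add_smul, Finset.sum_add_distrib]
       map_smul' c s := by
          ext
          change ∑ t, ((c • s t : weightPart k n a (-d t)) : MvPowerSeries (Fin 2) k) • e t =
            c • ∑ t, (s t : MvPowerSeries (Fin 2) k) • e t
          rw [Finset.smul_sum]
          refine Finset.sum_congr rfl fun t _ => ?_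
          rw [Submodule.coe_smul, smul_assoc] } :
      (∀ t, weightPart k n a (-d t)) →ₗ[weightRing k n a] 𝒢.zeroPart) <| by
    constructor
    · intro s s' h
      have h' := congrArg Subtype.val h
      change ∑ t, (s t : MvPowerSeries (Fin 2) k) • e t =
        ∑ t, (s' t : MvPowerSeries (Fin 2) k) • e t at h'
      funext t
      have := congrArg (fun x => e.repr x t) h'
      simpa [Finsupp.single_apply] using this
    · rintro ⟨x, hx⟩
      refine ⟨fun t => ⟨weightProj k n a (-d t) (e.repr x t), weightProj_mem _ _⟩, ?_⟩
      apply Subtype.ext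
      change ∑ t, weightProj k n a (-d t) (e.repr x t) • e t = x
      rw [mem_zeroPart] at hx
      conv_rhs => rw [← hx, ← e.sum_repr x, map_sum]
      refine Finset.sum_congr rfl fun t _ => ?_
      rw [𝒢.proj_smul_of_homogeneous (he t), zero_sub]

/-- If no basis element has degree ψ, the coordinates of z have nonzero weights, hence no constant
terms, and z lies in (u,v)N. -/
theorem exists_degree_eq {r : ℕ} (e : Module.Basis (Fin r) (MvPowerSeries (Fin 2) k) N)
    {d : Fin r → ZMod n} (he : ∀ t, 𝒢.proj (d t) (e t) = e t) {ψ : ZMod n} {z : N}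
    (hz : 𝒢.proj ψ z = z)
    (hm : ¬ ∃ x y : N, z = (X 0 : MvPowerSeries (Fin 2) k) • x +
      (X 1 : MvPowerSeries (Fin 2) k) • y) :
    ∃ t, d t = ψ := by
  by_contra! h
  apply hm
  have h0 : ∀ t, constantCoeff (weightProj k n a (ψ - d t) (e.repr z t)) = 0 := fun t =>
    constantCoeff_eq_zero_of_mem_weightPart (sub_ne_zero.2 (h t).symm) (weightProj_mem _ _)
  choose p q hpq using fun t => exists_eq_X_mul_add_X_mul (h0 t)
  refine ⟨∑ t, p t • e t, ∑ t, q t • e t, ?_⟩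
  conv_lhs => rw [← hz, ← e.sum_repr z, map_sum]
  rw [Finset.smul_sum, Finset.smul_sum, ← Finset.sum_add_distrib]
  refine Finset.sum_congr rfl fun t _ => ?_
  rw [𝒢.proj_smul_of_homogeneous (he t), hpq, add_smul, mul_smul, mul_smul]

end WeightGrading

end GradedModules

/-! ### The ring of power series of weight zero -/

section WeightRing

variable {k : Type u} [Field k] {n a : ℕ} [NeZero n]

omit [NeZero n] in
variable (k) in
theorem X_ne_zero (s : Fin 2) : (X s : MvPowerSeries (Fin 2) k) ≠ 0 := by
  classical
  intro h
  have := coeff_X (R := k) (Finsupp.single s 1) s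
  rw [h] at this
  simp at this

theorem exists_X_zero_pow_mem_weightPart (χ : ZMod n) :
    ∃ i, (X 0 : MvPowerSeries (Fin 2) k) ^ i ∈ weightPart k n a χ :=
  ⟨χ.val, by
    simpa using pow_mem_weightPart (X_zero_mem_weightPart (k := k) (n := n) (a := a)) χ.val⟩

theorem exists_X_one_pow_mem_weightPart (ha : Nat.Coprime a n) (χ : ZMod n) :
    ∃ i, (X 1 : MvPowerSeries (Fin 2) k) ^ i ∈ weightPart k n a χ := by
  -- The weight of v is a, which is invertible modulo n by coprimality.
  refine ⟨(χ * (a : ZMod n)⁻¹).val, ?_⟩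
  have := pow_mem_weightPart (X_one_mem_weightPart (k := k) (n := n) (a := a))
    (χ * (a : ZMod n)⁻¹).val
  rwa [ZMod.natCast_val, ZMod.cast_id', id, mul_assoc, mul_comm _ (a : ZMod n),
    ZMod.coe_mul_inv_eq_one a ha, mul_one] at this

omit [NeZero n] in
theorem X_pow_mem_weightRing (s : Fin 2) :
    (X s : MvPowerSeries (Fin 2) k) ^ n ∈ weightRing k n a := by
  rw [mem_weightRing]
  fin_cases s
  · simpa using pow_mem_weightPart (X_zero_mem_weightPart (k := k) (n := n) (a := a)) n
  · simpa using pow_mem_weightPart (X_one_mem_weightPart (k := k) (n := n) (a := a)) n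

variable (k n a) in
omit [NeZero n] in
/-- The ring `k[[u, v]]` retracts onto the power series of weight zero. -/
def reynolds : MvPowerSeries (Fin 2) k →ₗ[weightRing k n a] weightRing k n a where
  toFun f := ⟨weightProj k n a 0 f, weightProj_mem 0 f⟩
  map_add' f g := Subtype.ext (map_add _ f g)
  map_smul' r f := Subtype.ext (by
    have := weightProj_mul (ψ := 0) (mem_weightRing.1 r.2) f
    rwa [zero_add] at this)

omit [NeZero n] in
theorem reynolds_coe (r : weightRing k n a) : reynolds k n a r = r :=
  Subtype.ext (weightProj_of_mem r.2)

omit [NeZero n] in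
theorem reynolds_mem_of_mem_map {I : Ideal (weightRing k n a)} {f : MvPowerSeries (Fin 2) k}
    (hf : f ∈ I.map (algebraMap (weightRing k n a) (MvPowerSeries (Fin 2) k))) :
    reynolds k n a f ∈ I := by
  -- The claim is strengthened to all multiples of f because the projection is linear over R only.
  suffices h : ∀ s : MvPowerSeries (Fin 2) k, reynolds k n a (s * f) ∈ I by simpa using h 1
  induction hf using Submodule.span_induction with
  | mem x hx =>
    obtain ⟨r, hr, rfl⟩ := hx
    intro s
    rw [mul_comm, ← Algebra.smul_def, map_smul]
    exact I.mul_mem_right _ hr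
  | zero => simp
  | add x y _ _ hx hy =>
    intro s
    rw [mul_add, map_add]
    exact add_mem (hx s) (hy s)
  | smul c x _ hx =>
    intro s
    rw [smul_eq_mul, ← mul_assoc]
    exact hx _

omit [NeZero n] in
theorem mem_of_coe_mem_map {I : Ideal (weightRing k n a)} {r : weightRing k n a}
    (hr : (r : MvPowerSeries (Fin 2) k) ∈
      I.map (algebraMap (weightRing k n a) (MvPowerSeries (Fin 2) k))) : r ∈ I := by
  rw [← reynolds_coe r]
  exact reynolds_mem_of_mem_map hr

omit [NeZero n] in
theorem comap_map_weightRing (I : Ideal (weightRing k n a)) :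
    (I.map (algebraMap (weightRing k n a) (MvPowerSeries (Fin 2) k))).comap
      (algebraMap (weightRing k n a) (MvPowerSeries (Fin 2) k)) = I :=
  le_antisymm (fun _ hr => mem_of_coe_mem_map hr) Ideal.le_comap_map

/-- Hilbert's argument: the Reynolds operator gives IS ∩ R = I, so I ↦ IS embeds the ideals of R
strictly monotonically into those of the Noetherian ring S. -/
instance isNoetherianRing_weightRing : IsNoetherianRing (weightRing k n a) := by
  have hmono : StrictMono fun I : Ideal (weightRing k n a) =>
      I.map (algebraMap (weightRing k n a) (MvPowerSeries (Fin 2) k)) :=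
    Monotone.strictMono_of_injective (fun I J h => Ideal.map_mono h) fun I J h => by
      rw [← comap_map_weightRing I, ← comap_map_weightRing J]
      exact congrArg _ h
  have : WellFoundedGT (Ideal (weightRing k n a)) := hmono.wellFoundedGT
  exact (isNoetherian_iff' (R := weightRing k n a)).2 this

omit [NeZero n] in
theorem isUnit_weightRing_iff {r : weightRing k n a} :
    IsUnit r ↔ constantCoeff (r : MvPowerSeries (Fin 2) k) ≠ 0 := by
  constructor
  · intro h
    exact (isUnit_iff_constantCoeff.1
      (h.map (algebraMap (weightRing k n a) (MvPowerSeries (Fin 2) k)))).ne_zero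
  · intro h
    obtain ⟨w, hw⟩ := (isUnit_iff_constantCoeff.2 (isUnit_iff_ne_zero.2 h)).exists_right_inv
    refine IsUnit.of_mul_eq_one (reynolds k n a w) ?_
    rw [← smul_eq_mul, ← map_smul, Subalgebra.smul_def, smul_eq_mul, hw]
    exact reynolds_coe 1

omit [NeZero n] in
theorem mem_maximalIdeal_weightRing [IsLocalRing (weightRing k n a)] {r : weightRing k n a} :
    r ∈ IsLocalRing.maximalIdeal (weightRing k n a) ↔
      constantCoeff (r : MvPowerSeries (Fin 2) k) = 0 := by
  rw [IsLocalRing.mem_maximalIdeal, mem_nonunits_iff, isUnit_weightRing_iff, not_not]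

omit [NeZero n] in
theorem exists_injective_weightPart_of_mem {f : MvPowerSeries (Fin 2) k} (hf : f ≠ 0) {χ ψ : ZMod n}
    (hfχ : f ∈ weightPart k n a (ψ - χ)) :
    ∃ φ : weightPart k n a χ →ₗ[weightRing k n a] weightPart k n a ψ, Function.Injective φ := by
  refine ⟨LinearMap.codRestrict _ ((LinearMap.mulLeft _ f).domRestrict _) fun s => ?_,
    fun s t h => Subtype.ext (mul_left_cancel₀ hf (congrArg Subtype.val h))⟩
  have := mul_mem_weightPart hfχ s.2
  rwa [sub_add_cancel] at this

/-- Multiplication by a power of u embeds any piece into any other; this yields both finiteness and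
rank one. -/
theorem exists_injective_weightPart (χ ψ : ZMod n) :
    ∃ φ : weightPart k n a χ →ₗ[weightRing k n a] weightPart k n a ψ, Function.Injective φ := by
  obtain ⟨i, hi⟩ := exists_X_zero_pow_mem_weightPart (k := k) (a := a) (ψ - χ)
  exact exists_injective_weightPart_of_mem (pow_ne_zero _ (X_ne_zero k 0)) hi

variable (k n a) in
omit [NeZero n] in
/-- The part of weight zero is the base ring. -/
def weightPartZeroEquiv : weightPart k n a 0 ≃ₗ[weightRing k n a] weightRing k n a where
  toFun s := ⟨s, s.2⟩
  invFun r := ⟨r, r.2⟩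
  map_add' _ _ := rfl
  map_smul' _ _ := rfl
  left_inv _ := rfl
  right_inv _ := rfl

instance finite_weightPart (χ : ZMod n) :
    Module.Finite (weightRing k n a) (weightPart k n a χ) := by
  obtain ⟨φ, hφ⟩ := exists_injective_weightPart (k := k) (a := a) χ 0
  exact Module.Finite.of_injective ((weightPartZeroEquiv k n a).toLinearMap ∘ₗ φ)
    ((weightPartZeroEquiv k n a).injective.comp hφ)

instance finite_powerSeries :
    Module.Finite (weightRing k n a) (MvPowerSeries (Fin 2) k) := by
  refine Module.Finite.of_surjective
    (∑ χ, (weightPart k n a χ).subtype ∘ₗ LinearMap.proj χ :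
      (∀ χ, weightPart k n a χ) →ₗ[weightRing k n a] MvPowerSeries (Fin 2) k) fun f => ?_
  refine ⟨fun χ => ⟨weightProj k n a χ f, weightProj_mem χ f⟩, ?_⟩
  simpa using sum_weightProj f

/-! ### The dimension -/

/-- By Krull's height theorem it suffices that the maximal ideal is minimal over (uⁿ, vⁿ)R: if f =
ug + vw, then f²ⁿ lies in (uⁿ, vⁿ)S, and ideals of R are contracted from S. -/
theorem ringKrullDim_weightRing_le [IsLocalRing (weightRing k n a)] :
    ringKrullDim (weightRing k n a) ≤ 2 := by
  classical
  let x : Fin 2 → weightRing k n a := fun s => ⟨X s ^ n, X_pow_mem_weightRing s⟩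
  rw [← IsLocalRing.maximalIdeal_height_eq_ringKrullDim]
  have hx : ∀ s, x s ∈ IsLocalRing.maximalIdeal (weightRing k n a) := fun s => by
    rw [mem_maximalIdeal_weightRing]
    simp [x, NeZero.ne n]
  have hmin : IsLocalRing.maximalIdeal (weightRing k n a) ∈
      (Ideal.span ((Finset.univ.image x : Finset (weightRing k n a)) :
        Set (weightRing k n a))).minimalPrimes := by
    refine ⟨⟨inferInstance, ?_⟩, ?_⟩
    · rw [Ideal.span_le]
      intro y hy
      simp only [Finset.coe_image, Finset.coe_univ, Set.image_univ, Set.mem_range] at hy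
      obtain ⟨s, rfl⟩ := hy
      exact hx s
    · rintro P ⟨hP, hle⟩ - f hf
      obtain ⟨g, w, hgw⟩ := exists_eq_X_mul_add_X_mul (mem_maximalIdeal_weightRing.1 hf)
      refine hP.mem_of_pow_mem (n + n) (hle (mem_of_coe_mem_map ?_))
      have hX : ∀ s, (X s : MvPowerSeries (Fin 2) k) ^ n ∈ Ideal.map
          (algebraMap (weightRing k n a) (MvPowerSeries (Fin 2) k))
          (Ideal.span ((Finset.univ.image x : Finset (weightRing k n a)) :
            Set (weightRing k n a))) := fun s =>
        Ideal.mem_map_of_mem (algebraMap (weightRing k n a) (MvPowerSeries (Fin 2) k))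
          (Ideal.subset_span (by simp) : x s ∈ _)
      rw [SubmonoidClass.coe_pow, hgw]
      refine Ideal.add_pow_mem_of_pow_mem_of_le _ (m := n) (n := n) ?_ ?_ (by omega)
      · rw [mul_pow]; exact Ideal.mul_mem_right _ _ (hX 0)
      · rw [mul_pow]; exact Ideal.mul_mem_right _ _ (hX 1)
  have := Ideal.height_le_card_of_mem_minimalPrimes_span_finset hmin
  have h2 : (Finset.univ.image x).card ≤ 2 := Finset.card_image_le.trans (by simp)
  exact WithBot.coe_le_coe.2 (this.trans (by exact_mod_cast h2))

/-- The kernel of the substitution u = 0 is a prime strictly between zero and the maximal ideal: it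
contains uⁿ but not vⁿ. -/
theorem two_le_ringKrullDim_weightRing [IsLocalRing (weightRing k n a)] :
    2 ≤ ringKrullDim (weightRing k n a) := by
  have : IsDomain (MvPowerSeries (Fin 2) k) := NoZeroDivisors.to_isDomain _
  let ρ : weightRing k n a →+* MvPowerSeries (Fin 2) k :=
    (rescale ![0, 1]).comp (algebraMap (weightRing k n a) (MvPowerSeries (Fin 2) k))
  have hρ : ∀ f : weightRing k n a, ρ f = rescale ![0, 1] (f : MvPowerSeries (Fin 2) k) :=
    fun f => rfl
  let x : Fin 2 → weightRing k n a := fun s => ⟨X s ^ n, X_pow_mem_weightRing s⟩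
  have hρX : ∀ s, rescale ![0, 1] (X s : MvPowerSeries (Fin 2) k) = C (![0, 1] s) * X s := by
    intro s
    ext d
    rw [coeff_rescale, coeff_C_mul, coeff_X]
    split_ifs with h
    · simp [h]
    · simp
  have h0 : x 0 ∈ RingHom.ker ρ := by
    rw [RingHom.mem_ker, hρ]
    simp [x, hρX, NeZero.ne n]
  have h1 : x 1 ∉ RingHom.ker ρ := by
    rw [RingHom.mem_ker, hρ]
    simp [x, hρX, X_ne_zero]
  have : (RingHom.ker ρ).IsPrime := RingHom.ker_isPrime ρ
  have hbot : (⊥ : Ideal (weightRing k n a)) < RingHom.ker ρ := by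
    rw [bot_lt_iff_ne_bot]
    intro h
    rw [h, Ideal.mem_bot] at h0
    exact pow_ne_zero n (X_ne_zero k 0) (congrArg Subtype.val h0)
  have hlt : RingHom.ker ρ < IsLocalRing.maximalIdeal (weightRing k n a) := by
    refine lt_of_le_of_ne (IsLocalRing.le_maximalIdeal this.ne_top) fun h => h1 ?_
    rw [h, mem_maximalIdeal_weightRing]
    simp [x, NeZero.ne n]
  rw [← IsLocalRing.maximalIdeal_height_eq_ringKrullDim]
  have e1 := Ideal.height_add_one_le_of_lt_of_isPrime hbot
  have e2 := Ideal.height_add_one_le_of_lt_of_isPrime hlt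
  have e3 : (2 : ℕ∞) ≤ (IsLocalRing.maximalIdeal (weightRing k n a)).height := by
    refine le_trans ?_ e2
    refine le_trans ?_ (add_le_add_left e1 1)
    rw [add_assoc, one_add_one_eq_two]
    exact le_add_self
  exact WithBot.coe_le_coe.2 e3

theorem ringKrullDim_weightRing [IsLocalRing (weightRing k n a)] :
    ringKrullDim (weightRing k n a) = 2 :=
  le_antisymm ringKrullDim_weightRing_le two_le_ringKrullDim_weightRing

/-! ### Homomorphisms between the homogeneous parts -/

/-- Since nχ = 0, both sⁿ⁻¹t and sⁿ lie in R. Applying φ to sⁿ⁻¹t·s = sⁿ·t and cancelling sⁿ⁻¹ gives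
the claim. -/
theorem mul_map_comm {χ : ZMod n}
    (φ : weightPart k n a χ →ₗ[weightRing k n a] MvPowerSeries (Fin 2) k)
    (s t : weightPart k n a χ) :
    (s : MvPowerSeries (Fin 2) k) * φ t = t * φ s := by
  rcases eq_or_ne s 0 with rfl | hs
  · simp
  have hs' : (s : MvPowerSeries (Fin 2) k) ≠ 0 := fun h => hs (Subtype.ext h)
  obtain ⟨m, hm⟩ : ∃ m, n = m + 1 := ⟨n - 1, (Nat.succ_pred_eq_of_ne_zero (NeZero.ne n)).symm⟩
  have hχ : ((m : ZMod n) * χ + χ) = 0 := by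
    have : ((m : ZMod n) + 1) = ((m + 1 : ℕ) : ZMod n) := by push_cast; rfl
    rw [← add_one_mul, this, ← hm, ZMod.natCast_self, zero_mul]
  let c : weightRing k n a := ⟨s ^ m * t, by
    have := mul_mem_weightPart (pow_mem_weightPart s.2 m) t.2
    rwa [hχ] at this⟩
  let d : weightRing k n a := ⟨s ^ m * s, by
    have := mul_mem_weightPart (pow_mem_weightPart s.2 m) s.2
    rwa [hχ] at this⟩
  have h : c • φ s = d • φ t := by
    rw [← map_smul, ← map_smul]
    congr 1
    apply Subtype.ext
    change (s : MvPowerSeries (Fin 2) k) ^ m * t * s = s ^ m * s * t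
    ring
  apply mul_left_cancel₀ (pow_ne_zero m hs')
  change (s : MvPowerSeries (Fin 2) k) ^ m * t * φ s = s ^ m * s * φ t at h
  linear_combination -h

theorem multilinearMap_swap {ι : Type*} [DecidableEq ι] {χ : ι → ZMod n}
    (φ : MultilinearMap (weightRing k n a) (fun i => weightPart k n a (χ i))
      (MvPowerSeries (Fin 2) k)) (s t : ∀ i, weightPart k n a (χ i)) (A : Finset ι) :
    φ s * ∏ i ∈ A, (t i : MvPowerSeries (Fin 2) k) =
      φ (A.piecewise t s) * ∏ i ∈ A, (s i : MvPowerSeries (Fin 2) k) := by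
  induction A using Finset.induction_on with
  | empty => simp
  | insert i A hi ih =>
    have h := mul_map_comm (φ.toLinearMap (A.piecewise t s) i) (s i) (t i)
    have hs : Function.update (A.piecewise t s) i (s i) = A.piecewise t s := by
      rw [Function.update_eq_self_iff, Finset.piecewise_eq_of_notMem _ _ _ hi]
    rw [MultilinearMap.toLinearMap_apply, MultilinearMap.toLinearMap_apply, hs] at h
    rw [Finset.prod_insert hi, Finset.prod_insert hi, Finset.piecewise_insert]
    linear_combination (t i : MvPowerSeries (Fin 2) k) * ih -
      (∏ i ∈ A, (s i : MvPowerSeries (Fin 2) k)) * h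

/-- Compare φ(s) with its values at a tuple U of powers of u and a tuple V of powers of v.
Exchanging arguments gives φ(s)·uᴾ = φ(U)·∏ sᵢ, and s = V shows that uᴾ divides φ(U)·v^Q, hence
φ(U). The quotient is h. -/
theorem exists_multilinearMap_eq (ha : Nat.Coprime a n) {ι : Type*} [Fintype ι] {χ : ι → ZMod n}
    (φ : MultilinearMap (weightRing k n a) (fun i => weightPart k n a (χ i))
      (MvPowerSeries (Fin 2) k)) :
    ∃ h : MvPowerSeries (Fin 2) k, ∀ s, φ s = (∏ i, (s i : MvPowerSeries (Fin 2) k)) * h := by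
  classical
  choose p hp using fun i => exists_X_zero_pow_mem_weightPart (k := k) (a := a) (χ i)
  choose q hq using fun i => exists_X_one_pow_mem_weightPart (k := k) ha (χ i)
  let U : ∀ i, weightPart k n a (χ i) := fun i => ⟨_, hp i⟩
  let V : ∀ i, weightPart k n a (χ i) := fun i => ⟨_, hq i⟩
  have hsw : ∀ s, φ s * X 0 ^ (∑ i, p i) = φ U * ∏ i, (s i : MvPowerSeries (Fin 2) k) := by
    intro s
    have := multilinearMap_swap φ s U Finset.univ
    rwa [Finset.piecewise_univ, Finset.prod_pow_eq_pow_sum] at this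
  obtain ⟨h, hh⟩ : X 0 ^ (∑ i, p i) ∣ φ U := by
    apply X_pow_dvd_of_dvd_X_pow_mul (t := 1) (j := ∑ i, q i) (by decide)
    refine ⟨φ V, ?_⟩
    have := hsw V
    rw [Finset.prod_pow_eq_pow_sum] at this
    rw [mul_comm, ← this, mul_comm]
  refine ⟨h, fun s => ?_⟩
  apply mul_right_cancel₀ (pow_ne_zero (∑ i, p i) (X_ne_zero k 0))
  rw [hsw, hh]
  ring

theorem exists_linearMap_eq (ha : Nat.Coprime a n) {χ : ZMod n}
    (φ : weightPart k n a χ →ₗ[weightRing k n a] MvPowerSeries (Fin 2) k) :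
    ∃ h : MvPowerSeries (Fin 2) k, ∀ s, φ s = s * h := by
  obtain ⟨h, hh⟩ := exists_multilinearMap_eq ha
    (LinearMap.compMultilinearMap φ
      ((MultilinearMap.ofSubsingleton (weightRing k n a) (weightPart k n a χ) _ (0 : Fin 1))
        LinearMap.id))
  exact ⟨h, fun s => by simpa using hh fun _ => s⟩

theorem mem_weightPart_of_forall_prod_mul_mem {ι : Type*} [Fintype ι] {χ : ι → ZMod n} {ψ : ZMod n}
    {h : MvPowerSeries (Fin 2) k}
    (hh : ∀ s : ∀ i, weightPart k n a (χ i),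
      (∏ i, (s i : MvPowerSeries (Fin 2) k)) * h ∈ weightPart k n a (∑ i, χ i + ψ)) :
    h ∈ weightPart k n a ψ := by
  choose p hp using fun i => exists_X_zero_pow_mem_weightPart (k := k) (a := a) (χ i)
  have h1 := hh fun i => ⟨_, hp i⟩
  have h2 := prod_mem_weightPart Finset.univ fun i _ => hp i
  simp only [Finset.prod_pow_eq_pow_sum] at h1 h2
  exact mem_weightPart_of_mul_mem h2 h1

theorem eq_of_forall_prod_mul_eq {ι : Type*} [Fintype ι] (χ : ι → ZMod n)
    {h h' : MvPowerSeries (Fin 2) k}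
    (hh : ∀ s : ∀ i, weightPart k n a (χ i), (∏ i, (s i : MvPowerSeries (Fin 2) k)) * h =
      (∏ i, (s i : MvPowerSeries (Fin 2) k)) * h') : h = h' := by
  choose p hp using fun i => exists_X_zero_pow_mem_weightPart (k := k) (a := a) (χ i)
  have h1 := hh fun i => ⟨_, hp i⟩
  simp only [Finset.prod_pow_eq_pow_sum] at h1
  exact mul_left_cancel₀ (pow_ne_zero _ (X_ne_zero k 0)) h1

end WeightRing

/-! ### Maximal Cohen-Macaulay modules over the ring of power series of weight zero -/

section Retracts

variable {R : Type*} [CommRing R]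

theorem isCompl_range_ker_of_comp_eq_id {M P : Type*} [AddCommGroup M] [Module R M]
    [AddCommGroup P] [Module R P] {f : M →ₗ[R] P} {g : P →ₗ[R] M} (h : f ∘ₗ g = LinearMap.id) :
    IsCompl (LinearMap.range g) (LinearMap.ker f) := by
  have h' : ∀ y, f (g y) = y := fun y => LinearMap.congr_fun h y
  refine IsCompl.of_eq ?_ ?_
  · rw [eq_bot_iff]
    rintro _ ⟨⟨y, rfl⟩, hy⟩
    have hy' : f (g y) = 0 := hy
    rw [h'] at hy'
    simp [hy']
  · rw [eq_top_iff]
    intro x _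
    rw [← add_sub_cancel (g (f x)) x]
    exact Submodule.add_mem_sup ⟨_, rfl⟩ (by simp [h'])

theorem IsIndecomposable.exists_equiv_of_comp_eq_id {M P : Type*} [AddCommGroup M] [Module R M]
    [AddCommGroup P] [Module R P] [Nontrivial P] (hM : IsIndecomposable R M) {f : M →ₗ[R] P}
    {g : P →ₗ[R] M} (h : f ∘ₗ g = LinearMap.id) : Nonempty (M ≃ₗ[R] P) := by
  have h' : ∀ y, f (g y) = y := fun y => LinearMap.congr_fun h y
  refine ⟨LinearEquiv.ofBijective f ⟨?_, fun y => ⟨g y, h' y⟩⟩⟩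
  rw [← LinearMap.ker_eq_bot]
  refine (hM.2 _ _ (isCompl_range_ker_of_comp_eq_id h)).resolve_left fun h0 => ?_
  obtain ⟨y, hy⟩ := exists_ne (0 : P)
  apply hy
  rw [LinearMap.range_eq_bot] at h0
  rw [← h' y, h0, LinearMap.zero_apply, map_zero]

end Retracts

/-! ### Passing from a regular pair in the maximal ideal to the pair u, v -/

section Depth

variable {k : Type u} [Field k]

/-- If u does not divide x, some yⁱ is xc modulo u. On the u-torsion K this gives yⁱz = xcz, so z =
xt by regularity, and t is again in K. Hence K = xK, and Nakayama gives K = 0. -/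
theorem eq_zero_of_X_zero_smul_eq_zero {N : Type*} [AddCommGroup N]
    [Module (MvPowerSeries (Fin 2) k) N] [Module.Finite (MvPowerSeries (Fin 2) k) N]
    {x y : MvPowerSeries (Fin 2) k} (hx0 : constantCoeff x = 0) (hy0 : constantCoeff y = 0)
    (hx : ∀ z : N, x • z = 0 → z = 0) (hxy : ∀ z w : N, y • z = x • w → ∃ t, z = x • t)
    (z : N) (hz : (X 0 : MvPowerSeries (Fin 2) k) • z = 0) : z = 0 := by
  by_cases hdvd : X 0 ∣ x
  · obtain ⟨c, rfl⟩ := hdvd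
    exact hx z (by rw [mul_comm, mul_smul, hz, smul_zero])
  obtain ⟨i, c, d, hi⟩ := exists_pow_eq_mul_add_X_mul hy0 hdvd
  have hpow : ∀ (j : ℕ) (z w : N), y ^ j • z = x • w → ∃ t, z = x • t := by
    intro j
    induction j with
    | zero => intro z w h; exact ⟨w, by simpa using h⟩
    | succ j ih =>
      intro z w h
      rw [pow_succ', mul_smul] at h
      obtain ⟨t, ht⟩ := hxy _ _ h
      exact ih z t ht
  let K : Submodule (MvPowerSeries (Fin 2) k) N := Submodule.torsionBy _ N (X 0)
  have hK : ∀ z, z ∈ K ↔ (X 0 : MvPowerSeries (Fin 2) k) • z = 0 := fun z =>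
    Submodule.mem_torsionBy_iff _ _
  suffices h : K = ⊥ by
    rw [← Submodule.mem_bot (MvPowerSeries (Fin 2) k), ← h, hK]; exact hz
  refine Submodule.eq_bot_of_le_smul_of_le_jacobson_bot (Ideal.span {x}) K
    (IsNoetherian.noetherian K) ?_ ?_
  · intro z hz
    rw [hK] at hz
    obtain ⟨t, rfl⟩ := hpow i z (c • z) (by
      rw [hi, add_smul, mul_smul, mul_comm, mul_smul, hz, smul_zero, add_zero])
    refine Submodule.smul_mem_smul (Ideal.mem_span_singleton_self x) ((hK t).2 (hx _ ?_))
    rw [smul_comm, hz]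
  · rw [IsLocalRing.jacobson_eq_maximalIdeal _ bot_ne_top, Ideal.span_singleton_le_iff_mem,
      IsLocalRing.mem_maximalIdeal, mem_nonunits_iff, isUnit_iff_constantCoeff, hx0]
    exact not_isUnit_zero

/-- The class of z in N/uN is killed by (u,v), so xz = up and yz = uq. Cancelling u gives yp = xq,
so p = xt, and cancelling x gives z = ut. -/
theorem exists_eq_X_zero_smul {N : Type*} [AddCommGroup N]
    [Module (MvPowerSeries (Fin 2) k) N]
    {x y : MvPowerSeries (Fin 2) k} (hx0 : constantCoeff x = 0) (hy0 : constantCoeff y = 0)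
    (hx : ∀ z : N, x • z = 0 → z = 0) (hxy : ∀ z w : N, y • z = x • w → ∃ t, z = x • t)
    (hu : ∀ z : N, (X 0 : MvPowerSeries (Fin 2) k) • z = 0 → z = 0)
    (z w : N) (hz : (X 1 : MvPowerSeries (Fin 2) k) • z = (X 0 : MvPowerSeries (Fin 2) k) • w) :
    ∃ t, z = (X 0 : MvPowerSeries (Fin 2) k) • t := by
  have key : ∀ s : MvPowerSeries (Fin 2) k, constantCoeff s = 0 →
      ∃ t, s • z = (X 0 : MvPowerSeries (Fin 2) k) • t := by
    intro s hs
    obtain ⟨p, q, rfl⟩ := exists_eq_X_mul_add_X_mul hs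
    refine ⟨p • z + q • w, ?_⟩
    rw [add_smul, mul_smul, mul_comm, mul_smul, hz, smul_add, smul_comm q]
  obtain ⟨p, hp⟩ := key x hx0
  obtain ⟨q, hq⟩ := key y hy0
  have h1 : y • p = x • q := by
    rw [← sub_eq_zero]
    apply hu
    rw [smul_sub, smul_comm _ y, smul_comm _ x, ← hp, ← hq, smul_comm, sub_self]
  obtain ⟨t, rfl⟩ := hxy _ _ h1
  refine ⟨t, ?_⟩
  rw [← sub_eq_zero]
  apply hx
  rw [smul_sub, hp, smul_comm, sub_self]

theorem exists_regular_pair_of_two_le_depth {R : Type*} [CommRing R] [IsLocalRing R] {M : Type*}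
    [AddCommGroup M] [Module R M] (h : 2 ≤ depth R M) :
    ∃ x ∈ IsLocalRing.maximalIdeal R, ∃ y ∈ IsLocalRing.maximalIdeal R,
      (∀ z : M, x • z = 0 → z = 0) ∧ ∀ z w : M, y • z = x • w → ∃ t, z = x • t := by
  have h1 : 1 < depth R M := lt_of_lt_of_le (by norm_num) h
  simp only [depth, lt_iSup_iff] at h1
  obtain ⟨rs, ⟨hmem, hreg⟩, hlen⟩ := h1
  match rs, hmem, hreg, hlen with
  | [], _, _, hlen => simp at hlen
  | [x], _, _, hlen => simp at hlen
  | x :: y :: l, hmem, hreg, _ =>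
    have hw := hreg.toIsWeaklyRegular
    rw [RingTheory.Sequence.isWeaklyRegular_cons_iff,
      RingTheory.Sequence.isWeaklyRegular_cons_iff] at hw
    obtain ⟨hx, hy, -⟩ := hw
    refine ⟨x, hmem x (by simp), y, hmem y (by simp), fun z hz => ?_, fun z w hzw => ?_⟩
    · exact hx (by simpa using hz)
    · have h0 : (Submodule.Quotient.mk z : QuotSMulTop x M) = 0 := by
        apply hy
        change y • (Submodule.Quotient.mk z : QuotSMulTop x M) = y • 0
        rw [smul_zero, ← Submodule.Quotient.mk_smul, Submodule.Quotient.mk_eq_zero, hzw]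
        exact Submodule.smul_mem_pointwise_smul _ _ _ Submodule.mem_top
      rw [Submodule.Quotient.mk_eq_zero] at h0
      obtain ⟨t, -, rfl⟩ := h0
      exact ⟨t, rfl⟩

end Depth

/-! ### The graded module Hom_R(k[[u,v]], M) and maximal Cohen–Macaulay modules -/

section Coinduced

variable (k : Type u) [Field k] (n a : ℕ) (M : Type v) [AddCommGroup M]
  [Module (weightRing k n a) M]

/-- The module `Hom_R(k[[u, v]], M)` over `k[[u, v]]`. -/
def Coinduced : Type (max u v) := MvPowerSeries (Fin 2) k →ₗ[weightRing k n a] M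

namespace Coinduced

instance : AddCommGroup (Coinduced k n a M) :=
  inferInstanceAs (AddCommGroup (MvPowerSeries (Fin 2) k →ₗ[weightRing k n a] M))

instance : FunLike (Coinduced k n a M) (MvPowerSeries (Fin 2) k) M :=
  inferInstanceAs (FunLike (MvPowerSeries (Fin 2) k →ₗ[weightRing k n a] M) _ _)

instance : LinearMapClass (Coinduced k n a M) (weightRing k n a) (MvPowerSeries (Fin 2) k) M :=
  inferInstanceAs (LinearMapClass (MvPowerSeries (Fin 2) k →ₗ[weightRing k n a] M) _ _ _)

variable {k n a M}

@[ext]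
theorem ext {φ ψ : Coinduced k n a M} (h : ∀ f, φ f = ψ f) : φ = ψ := LinearMap.ext h

theorem add_apply (φ ψ : Coinduced k n a M) (f : MvPowerSeries (Fin 2) k) :
    (φ + ψ) f = φ f + ψ f := rfl

theorem zero_apply (f : MvPowerSeries (Fin 2) k) : (0 : Coinduced k n a M) f = 0 := rfl

instance : SMul (MvPowerSeries (Fin 2) k) (Coinduced k n a M) where
  smul s φ := LinearMap.comp (M₂ := MvPowerSeries (Fin 2) k) φ (LinearMap.mulLeft _ s)

theorem smul_apply (s : MvPowerSeries (Fin 2) k) (φ : Coinduced k n a M)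
    (f : MvPowerSeries (Fin 2) k) : (s • φ) f = φ (s * f) := rfl

instance : Module (MvPowerSeries (Fin 2) k) (Coinduced k n a M) where
  one_smul φ := by ext f; rw [smul_apply, one_mul]
  mul_smul s t φ := by ext f; simp only [smul_apply]; ring_nf
  smul_zero s := rfl
  smul_add s φ ψ := rfl
  add_smul s t φ := by ext f; simp only [smul_apply, add_apply, add_mul, map_add]
  zero_smul φ := by ext f; rw [smul_apply, zero_mul, map_zero, zero_apply]

theorem coe_smul_apply (r : weightRing k n a) (φ : Coinduced k n a M)
    (f : MvPowerSeries (Fin 2) k) : (r • φ) f = r • φ f := by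
  change φ (r • f) = _
  exact map_smul φ r f

variable [NeZero n]

instance [Module.Finite (weightRing k n a) M] :
    Module.Finite (MvPowerSeries (Fin 2) k) (Coinduced k n a M) := by
  obtain ⟨s, hs⟩ := Module.Finite.fg_top (R := weightRing k n a) (M := MvPowerSeries (Fin 2) k)
  let ev : Coinduced k n a M →ₗ[weightRing k n a] (s → M) :=
    { toFun φ g := φ g
      map_add' _ _ := rfl
      map_smul' r φ := funext fun g => coe_smul_apply r φ g }
  have : Module.Finite (weightRing k n a) (Coinduced k n a M) := by
    refine Module.Finite.of_injective ev fun φ ψ h => ?_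
    exact LinearMap.ext_on hs fun g hg => congrFun h ⟨g, hg⟩
  exact Module.Finite.of_restrictScalars_finite (weightRing k n a) (MvPowerSeries (Fin 2) k) _

variable (k n a) in
omit [NeZero n] in
/-- The projection to the part of weight `χ`, as a linear map. -/
def weightProjLinear (χ : ZMod n) :
    MvPowerSeries (Fin 2) k →ₗ[weightRing k n a] MvPowerSeries (Fin 2) k where
  toFun := weightProj k n a χ
  map_add' := map_add _
  map_smul' r f := by
    have := weightProj_mul (ψ := χ) (mem_weightRing.1 r.2) f
    rwa [zero_add] at this

variable (k n a M) in
/-- The grading of `Hom_R(k[[u, v]], M)` induced by the grading of `k[[u, v]]`. -/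
def grading : WeightGrading k n a (Coinduced k n a M) where
  proj χ :=
    -- Degree χ means being supported on weight -χ: as s acts by precomposition, this sign makes an
    -- element of weight χ raise degrees by χ.
    { toFun φ := LinearMap.comp (M₂ := MvPowerSeries (Fin 2) k) φ (weightProjLinear k n a (-χ))
      map_zero' := rfl
      map_add' _ _ := rfl }
  sum_proj φ := by
    ext f
    have h : ∀ (A : Finset (ZMod n)) (F : ZMod n → Coinduced k n a M),
        (∑ χ ∈ A, F χ) f = ∑ χ ∈ A, F χ f := fun A F =>
      LinearMap.sum_apply (M := MvPowerSeries (Fin 2) k) A F f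
    rw [h]
    change ∑ χ, φ (weightProj k n a (-χ) f) = φ f
    rw [← map_sum]
    congr 1
    rw [← sum_weightProj (n := n) (a := a) f]
    exact Fintype.sum_equiv (Equiv.neg _) _ _ fun χ => by simp [sum_weightProj]
  proj_proj χ φ := by
    ext f
    change φ (weightProj k n a (-χ) (weightProj k n a (-χ) f)) = φ (weightProj k n a (-χ) f)
    rw [weightProj_of_mem (weightProj_mem _ f)]
  proj_proj_of_ne χ ψ h φ := by
    ext f
    change φ (weightProj k n a (-ψ) (weightProj k n a (-χ) f)) = 0
    rw [weightProj_of_mem_of_ne _ (weightProj_mem _ f), map_zero]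
    simpa using h.symm
  proj_smul χ ψ s hs φ := by
    ext f
    change φ (s * weightProj k n a (-(χ + ψ)) f) = φ (weightProj k n a (-ψ) (s * f))
    rw [← weightProj_mul hs f]
    ring_nf

variable (k n a M) in
/-- The part of degree zero of `Hom_R(k[[u, v]], M)` is `M`. -/
def zeroPartEquiv : (grading k n a M).zeroPart ≃ₗ[weightRing k n a] M where
  toFun φ := (φ : Coinduced k n a M) 1
  map_add' _ _ := rfl
  map_smul' r φ := coe_smul_apply r φ.1 1
  -- A map of degree zero factors through the projection onto R, so it is determined by its value at
  -- 1.
  invFun m := ⟨LinearMap.comp (M₂ := weightRing k n a)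
      (LinearMap.toSpanSingleton (weightRing k n a) M m) (reynolds k n a), by
    refine (grading k n a M).mem_zeroPart.2 ?_
    ext f
    change (reynolds k n a (weightProj k n a (-0) f)) • m = reynolds k n a f • m
    congr 1
    apply Subtype.ext
    change weightProj k n a 0 (weightProj k n a (-0) f) = weightProj k n a 0 f
    rw [neg_zero, weightProj_of_mem (weightProj_mem _ f)]⟩
  left_inv φ := by
    obtain ⟨φ, hφ⟩ := φ
    apply Subtype.ext
    ext f
    change reynolds k n a f • φ 1 = φ f
    rw [WeightGrading.mem_zeroPart] at hφ
    have h1 : φ (weightProj k n a (-0) f) = φ f := congrArg (fun ψ : Coinduced k n a M => ψ f) hφ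
    rw [← h1, neg_zero, ← map_smul φ, Subalgebra.smul_def, smul_eq_mul, mul_one]
    rfl
  right_inv m := by
    change reynolds k n a 1 • m = m
    rw [show reynolds k n a 1 = 1 from reynolds_coe 1, one_smul]

end Coinduced

variable {k n a M} [NeZero n]

/-- A regular pair on M remains one on Hom_R(S,M), as x-divisibility is checked value by value. Over
S it can be exchanged for u, v, which gives a homogeneous basis; M is the part of degree zero. -/
theorem exists_equiv_of_regular_pair [Module.Finite (weightRing k n a) M] {x y : weightRing k n a}
    (hx0 : constantCoeff (x : MvPowerSeries (Fin 2) k) = 0)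
    (hy0 : constantCoeff (y : MvPowerSeries (Fin 2) k) = 0)
    (hx : ∀ z : M, x • z = 0 → z = 0) (hxy : ∀ z w : M, y • z = x • w → ∃ t, z = x • t) :
    ∃ (r : ℕ) (χ : Fin r → ZMod n),
      Nonempty (M ≃ₗ[weightRing k n a] ∀ t, weightPart k n a (χ t)) := by
  have hx' : ∀ φ : Coinduced k n a M, (x : MvPowerSeries (Fin 2) k) • φ = 0 → φ = 0 := by
    intro φ h
    ext f
    apply hx
    rw [← Coinduced.coe_smul_apply]
    exact congrArg (fun ψ : Coinduced k n a M => ψ f) h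
  have hxy' : ∀ φ ψ : Coinduced k n a M, (y : MvPowerSeries (Fin 2) k) • φ =
      (x : MvPowerSeries (Fin 2) k) • ψ → ∃ θ, φ = (x : MvPowerSeries (Fin 2) k) • θ := by
    intro φ ψ h
    have h1 : ∀ f, ∃ t, φ f = x • t := fun f => hxy (φ f) (ψ f) (by
      rw [← Coinduced.coe_smul_apply, ← Coinduced.coe_smul_apply]
      exact congrArg (fun ψ : Coinduced k n a M => ψ f) h)
    choose θ hθ using h1
    have hinj : ∀ z w : M, x • z = x • w → z = w := fun z w h => by
      rw [← sub_eq_zero]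
      exact hx _ (by rw [smul_sub, h, sub_self])
    let θ' : Coinduced k n a M :=
      { toFun := θ
        map_add' f g := hinj _ _ (by rw [smul_add, ← hθ, ← hθ, ← hθ, map_add])
        map_smul' r f := hinj _ _ (by
          rw [RingHom.id_apply, smul_comm, ← hθ, ← hθ, map_smul]) }
    refine ⟨θ', ?_⟩
    ext f
    exact (hθ f).trans (Coinduced.coe_smul_apply x θ' f).symm
  have hu := eq_zero_of_X_zero_smul_eq_zero hx0 hy0 hx' hxy'
  obtain ⟨r, e, d, he⟩ := (Coinduced.grading k n a M).exists_homogeneous_basis hu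
    (exists_eq_X_zero_smul hx0 hy0 hx' hxy' hu)
  exact ⟨r, fun t => -d t, ⟨(Coinduced.zeroPartEquiv k n a M).symm ≪≫ₗ
    ((Coinduced.grading k n a M).zeroPartEquiv e he).symm⟩⟩

instance nontrivial_weightPart (χ : ZMod n) : Nontrivial (weightPart k n a χ) := by
  obtain ⟨i, hi⟩ := exists_X_zero_pow_mem_weightPart (k := k) (a := a) χ
  exact ⟨⟨_, hi⟩, 0, fun h => pow_ne_zero i (X_ne_zero k 0) (congrArg Subtype.val h)⟩

theorem exists_equiv_weightPart_of_isMCM [IsLocalRing (weightRing k n a)]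
    (hM : IsMCM (weightRing k n a) M) (hM' : IsIndecomposable (weightRing k n a) M) :
    ∃ χ : ZMod n, Nonempty (M ≃ₗ[weightRing k n a] weightPart k n a χ) := by
  have := hM.1
  have hdepth : 2 ≤ depth (weightRing k n a) M := by
    have := hM.2
    rw [ringKrullDim_weightRing] at this
    exact (WithBot.coe_inj.1 this).ge
  obtain ⟨x, hx0, y, hy0, hx, hxy⟩ := exists_regular_pair_of_two_le_depth hdepth
  rw [mem_maximalIdeal_weightRing] at hx0 hy0
  obtain ⟨r, χ, ⟨e⟩⟩ := exists_equiv_of_regular_pair hx0 hy0 hx hxy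
  have := hM'.1
  rcases Nat.eq_zero_or_pos r with rfl | hr
  · exact absurd e.toEquiv.subsingleton (not_subsingleton M)
  let f : M →ₗ[weightRing k n a] weightPart k n a (χ ⟨0, hr⟩) :=
    LinearMap.proj (⟨0, hr⟩ : Fin r) ∘ₗ e.toLinearMap
  let g : weightPart k n a (χ ⟨0, hr⟩) →ₗ[weightRing k n a] M :=
    e.symm.toLinearMap ∘ₗ LinearMap.single _ (fun t => weightPart k n a (χ t)) ⟨0, hr⟩
  have hfg : f ∘ₗ g = LinearMap.id := by
    ext s
    simp [f, g]
  exact ⟨χ ⟨0, hr⟩, hM'.exists_equiv_of_comp_eq_id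
    (P := weightPart k n a (χ ⟨0, hr⟩)) hfg⟩

end Coinduced

/-! ### Multiplicities of direct summands -/

section Multiplicity

variable {R : Type*} [CommRing R] {κ : Type*} [Field κ] {M : Type*} [AddCommGroup M] [Module R M]
  {X : Type*} [AddCommGroup X] [Module R X]

/-- `X` is the direct sum of a copy of `M ^ ι` and of a module such that all endomorphisms of `M`
that factor through it are killed by the character `ε` of the endomorphism ring of `M`. -/
def SplitsOff (ε : Module.End R M →+* κ) (X : Type*) [AddCommGroup X] [Module R X]
    (ι : Type*) : Prop :=
  ∃ (i : (ι → M) →ₗ[R] X) (p : X →ₗ[R] (ι → M)), p ∘ₗ i = LinearMap.id ∧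
    ∀ (f : M →ₗ[R] X) (g : X →ₗ[R] M), ε (g ∘ₗ (LinearMap.id - i ∘ₗ p) ∘ₗ f) = 0

/-- Applying ε to the matrix entries of gi and pf gives matrices A and B over κ. Since gf is the
identity and ε kills whatever passes through the complement, AB = 1, and the rank of A bounds the
size. -/
theorem SplitsOff.card_le {ε : Module.End R M →+* κ} {ι ι' : Type*} [Fintype ι] [Fintype ι']
    (h : SplitsOff ε X ι) {f : (ι' → M) →ₗ[R] X} {g : X →ₗ[R] (ι' → M)}
    (hgf : g ∘ₗ f = LinearMap.id) : Fintype.card ι' ≤ Fintype.card ι := by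
  classical
  obtain ⟨i, p, -, hε⟩ := h
  let A : Matrix ι' ι κ := fun r t =>
    ε (LinearMap.proj r ∘ₗ g ∘ₗ i ∘ₗ LinearMap.single R (fun _ => M) t)
  let B : Matrix ι ι' κ := fun t s =>
    ε (LinearMap.proj t ∘ₗ p ∘ₗ f ∘ₗ LinearMap.single R (fun _ => M) s)
  have hAB : A * B = 1 := by
    ext r s
    have h1 := hε (f ∘ₗ LinearMap.single R (fun _ => M) s) (LinearMap.proj r ∘ₗ g)
    have h2 : (LinearMap.proj r ∘ₗ g) ∘ₗ (LinearMap.id - i ∘ₗ p) ∘ₗ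
          (f ∘ₗ LinearMap.single R (fun _ => M) s) =
        (if r = s then (1 : Module.End R M) else 0) -
        ∑ t, (LinearMap.proj r ∘ₗ g ∘ₗ i ∘ₗ LinearMap.single R (fun _ => M) t : Module.End R M) *
          (LinearMap.proj t ∘ₗ p ∘ₗ f ∘ₗ LinearMap.single R (fun _ => M) s : Module.End R M) := by
      ext m
      have e1 : g (f (Pi.single s m)) = Pi.single s m := LinearMap.congr_fun hgf _
      have e2 : (∑ t, (LinearMap.proj r ∘ₗ g ∘ₗ i ∘ₗ LinearMap.single R (fun _ => M) t :
          Module.End R M) * (LinearMap.proj t ∘ₗ p ∘ₗ f ∘ₗ LinearMap.single R (fun _ => M) s :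
            Module.End R M)) m = g (i (p (f (Pi.single s m)))) r := by
        rw [LinearMap.sum_apply]
        have e3 : p (f (Pi.single s m)) = ∑ t, Pi.single t (p (f (Pi.single s m)) t) :=
          (Finset.univ_sum_single _).symm
        conv_rhs => rw [e3, map_sum, map_sum, Finset.sum_apply]
        rfl
      rw [LinearMap.sub_apply, e2]
      change (g (f (Pi.single s m) - i (p (f (Pi.single s m))))) r = _
      rw [map_sub, e1, Pi.sub_apply]
      congr 1
      split_ifs with hrs
      · subst hrs; simp
      · simp [hrs]
    rw [h2, map_sub, map_sum, sub_eq_zero] at h1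
    rw [Matrix.mul_apply, Matrix.one_apply]
    simp only [map_mul] at h1
    rw [← h1]
    split_ifs <;> simp
  have h1 := Matrix.rank_mul_le_left A B
  rw [hAB, Matrix.rank_one] at h1
  exact h1.trans (Matrix.rank_le_card_width A)

theorem SplitsOff.card_eq {ε : Module.End R M →+* κ} {ι ι' : Type*} [Fintype ι] [Fintype ι']
    (h : SplitsOff ε X ι) (h' : SplitsOff ε X ι') : Fintype.card ι = Fintype.card ι' := by
  obtain ⟨i, p, hip, -⟩ := id h
  obtain ⟨i', p', hip', -⟩ := id h'
  exact le_antisymm (h'.card_le hip) (h.card_le hip')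

/-- A copy of M inside the complement would make the identity of M factor through it, although ε(1)
= 1. -/
theorem SplitsOff.isMultiplicity {ε : Module.End R M →+* κ} {b : ℕ}
    (h : SplitsOff ε X (Fin b)) : IsMultiplicity R M X b := by
  obtain ⟨i, p, hip, hε⟩ := h
  have hip' : ∀ m, p (i m) = m := fun m => LinearMap.congr_fun hip m
  refine ⟨LinearMap.range i, LinearMap.ker p, isCompl_range_ker_of_comp_eq_id hip,
    ⟨(LinearEquiv.ofInjective i (Function.LeftInverse.injective hip')).symm⟩, ?_⟩
  rintro ⟨P, N, hPN, ⟨e⟩⟩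
  let j : X →ₗ[R] LinearMap.ker p := LinearMap.codRestrict _ (LinearMap.id - i ∘ₗ p) fun x => by
    simp [hip']
  have hj : ∀ x : LinearMap.ker p, j x = x := fun x => by
    apply Subtype.ext
    change (x : X) - i (p x) = x
    rw [x.2, map_zero, sub_zero]
  let g : X →ₗ[R] M := e.toLinearMap ∘ₗ P.projectionOnto N hPN ∘ₗ j
  let f : M →ₗ[R] X := (LinearMap.ker p).subtype ∘ₗ P.subtype ∘ₗ e.symm.toLinearMap
  have h1 := hε f g
  have h2 : g ∘ₗ (LinearMap.id - i ∘ₗ p) ∘ₗ f = (1 : Module.End R M) := by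
    ext m
    change e (P.projectionOnto N hPN (j (j (e.symm m : LinearMap.ker p)))) = m
    rw [hj, hj]
    simp
  rw [h2, map_one] at h1
  exact one_ne_zero h1

/-- An endomorphism of M through the complement with nonzero ε is invertible, and would split M off
the complement. -/
theorem IsMultiplicity.splitsOff {ε : Module.End R M →+* κ}
    (hε : ∀ φ : Module.End R M, ε φ ≠ 0 → IsUnit φ) {b : ℕ}
    (h : IsMultiplicity R M X b) : SplitsOff ε X (Fin b) := by
  obtain ⟨P, N, hPN, ⟨e⟩, hN⟩ := h
  let i : (Fin b → M) →ₗ[R] X := P.subtype ∘ₗ e.symm.toLinearMap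
  let p : X →ₗ[R] (Fin b → M) := e.toLinearMap ∘ₗ P.projectionOnto N hPN
  have hi : ∀ x, i (p x) = P.projectionOnto N hPN x := fun x => by simp [i, p]
  refine ⟨i, p, LinearMap.ext fun m => by simp [i, p], fun f g => ?_⟩
  by_contra hne
  let j : X →ₗ[R] N := LinearMap.codRestrict _ (LinearMap.id - i ∘ₗ p) fun x => by
    rw [← Submodule.projectionOnto_apply_eq_zero_iff hPN, LinearMap.sub_apply,
      LinearMap.comp_apply, hi, map_sub, Submodule.projectionOnto_apply_left, LinearMap.id_apply,
      sub_self]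
  obtain ⟨φ, hφ⟩ := hε _ hne
  have hcomp : ((φ⁻¹ : (Module.End R M)ˣ).val ∘ₗ g ∘ₗ N.subtype) ∘ₗ (j ∘ₗ f) =
      LinearMap.id := by
    have h1 : (φ⁻¹ : (Module.End R M)ˣ).val * φ.val = 1 := φ.inv_mul
    rw [hφ] at h1
    exact h1
  have hinv : Function.LeftInverse ((φ⁻¹ : (Module.End R M)ˣ).val ∘ₗ g ∘ₗ N.subtype) (j ∘ₗ f) :=
    LinearMap.congr_fun hcomp
  exact hN ⟨_, _, isCompl_range_ker_of_comp_eq_id hcomp,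
    ⟨(LinearEquiv.ofInjective (j ∘ₗ f) hinv.injective).symm⟩⟩

theorem SplitsOff.congr {ε : Module.End R M →+* κ} {ι : Type*} (h : SplitsOff ε X ι)
    {M' X' ι' : Type*} [AddCommGroup M'] [Module R M'] [AddCommGroup X'] [Module R X']
    (e : X ≃ₗ[R] X') (e' : M' ≃ₗ[R] M) (eι : ι ≃ ι') :
    SplitsOff (ε.comp (e'.conjRingEquiv : Module.End R M' →+* Module.End R M)) X' ι' := by
  obtain ⟨i, p, hip, hε⟩ := h
  let c : (ι' → M') ≃ₗ[R] (ι → M) :=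
    LinearEquiv.funCongrLeft R M' eι ≪≫ₗ LinearEquiv.piCongrRight fun _ => e'
  refine ⟨e.toLinearMap ∘ₗ i ∘ₗ c.toLinearMap, c.symm.toLinearMap ∘ₗ p ∘ₗ e.symm.toLinearMap,
    ?_, fun f g => ?_⟩
  · ext1 m
    have h1 : p (i (c m)) = c m := LinearMap.congr_fun hip _
    simp [h1]
  · refine Eq.trans (congrArg ε ?_) (hε (e.symm.toLinearMap ∘ₗ f ∘ₗ e'.symm.toLinearMap)
      (e'.toLinearMap ∘ₗ g ∘ₗ e.toLinearMap))
    ext m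
    simp [LinearEquiv.conjRingEquiv]

theorem SplitsOff.isMultiplicity_iff {ε : Module.End R M →+* κ}
    (hε : ∀ φ : Module.End R M, ε φ ≠ 0 → IsUnit φ) {ι : Type*} [Fintype ι]
    (h : SplitsOff ε X ι) (b : ℕ) : IsMultiplicity R M X b ↔ b = Fintype.card ι := by
  constructor
  · intro hb
    simpa using (hb.splitsOff hε).card_eq h
  · rintro rfl
    have h' := h.congr (LinearEquiv.refl R X) (LinearEquiv.refl R M) (Fintype.equivFin ι)
    exact h'.isMultiplicity

theorem SplitsOff.freeRank_eq {ε : Module.End R R →+* κ} {ι : Type*} [Fintype ι]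
    (h : SplitsOff ε X ι) : freeRank R X = Fintype.card ι := by
  refine IsGreatest.csSup_eq ⟨?_, ?_⟩
  · obtain ⟨i, p, hip, -⟩ := h.congr (LinearEquiv.refl R X) (LinearEquiv.refl R R)
      (Fintype.equivFin ι)
    exact ⟨p, i, hip⟩
  · rintro m ⟨φ, ψ, hφψ⟩
    simpa using h.card_le hφψ

end Multiplicity

/-! ### Multiplicities and ranks of direct sums of weight parts -/

section WeightParts

variable {k : Type u} [Field k] {n a : ℕ} [NeZero n]

/-- Each endomorphism is multiplication by a unique h, necessarily of weight zero; ε is its constant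
term, and it is nonzero exactly when h is a unit of R. -/
theorem exists_character (ha : Nat.Coprime a n) (χ : ZMod n) :
    ∃ ε : Module.End (weightRing k n a) (weightPart k n a χ) →+* k,
      (∀ (φ : Module.End (weightRing k n a) (weightPart k n a χ)) (h : MvPowerSeries (Fin 2) k),
        (∀ s, (φ s : MvPowerSeries (Fin 2) k) = s * h) → ε φ = constantCoeff h) ∧
      ∀ φ, ε φ ≠ 0 → IsUnit φ := by
  have hex : ∀ φ : Module.End (weightRing k n a) (weightPart k n a χ),
      ∃ h : MvPowerSeries (Fin 2) k, ∀ s, (φ s : MvPowerSeries (Fin 2) k) = s * h := fun φ =>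
    exists_linearMap_eq ha ((weightPart k n a χ).subtype ∘ₗ φ)
  choose H hH using hex
  have huniq : ∀ (φ : Module.End (weightRing k n a) (weightPart k n a χ))
      (h : MvPowerSeries (Fin 2) k),
      (∀ s, (φ s : MvPowerSeries (Fin 2) k) = s * h) → H φ = h := by
    intro φ h hφ
    refine eq_of_forall_prod_mul_eq (n := n) (a := a) (fun _ : Fin 1 => χ) fun s => ?_
    rw [Fin.prod_univ_one, ← hφ, ← hH]
  refine ⟨⟨⟨⟨fun φ => constantCoeff (H φ), ?_⟩, ?_⟩, ?_, ?_⟩, fun φ h hφ => ?_, fun φ hφ => ?_⟩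
  · rw [huniq 1 1 fun s => by simp, map_one]
  · intro φ ψ
    change constantCoeff (H (φ * ψ)) = constantCoeff (H φ) * constantCoeff (H ψ)
    rw [huniq (φ * ψ) (H φ * H ψ) fun s => by
      rw [Module.End.mul_apply, hH, hH]; ring, map_mul]
  · change constantCoeff (H 0) = 0
    rw [huniq 0 0 fun s => by simp, map_zero]
  · intro φ ψ
    change constantCoeff (H (φ + ψ)) = constantCoeff (H φ) + constantCoeff (H ψ)
    rw [huniq (φ + ψ) (H φ + H ψ) fun s => by
      rw [LinearMap.add_apply, Submodule.coe_add, hH, hH]; ring, map_add]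
  · exact congrArg constantCoeff (huniq φ h hφ)
  · change constantCoeff (H φ) ≠ 0 at hφ
    have hmem : H φ ∈ weightRing k n a := by
      rw [mem_weightRing]
      refine mem_weightPart_of_forall_prod_mul_mem (χ := fun _ : Fin 1 => χ) fun s => ?_
      rw [Fin.prod_univ_one, ← hH]
      simp
    obtain ⟨w, hw⟩ := (isUnit_weightRing_iff (r := ⟨H φ, hmem⟩).2 hφ).exists_right_inv
    have hw' : H φ * w = 1 := congrArg Subtype.val hw
    refine isUnit_iff_exists.2 ⟨LinearMap.lsmul (weightRing k n a) (weightPart k n a χ) w, ?_, ?_⟩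
    · ext s : 2
      rw [Module.End.mul_apply, hH]
      change (w : MvPowerSeries (Fin 2) k) * s * H φ = s
      linear_combination (s : MvPowerSeries (Fin 2) k) * hw'
    · ext s : 2
      rw [Module.End.mul_apply]
      change (w : MvPowerSeries (Fin 2) k) * (φ s : MvPowerSeries (Fin 2) k) = s
      rw [hH]
      linear_combination (s : MvPowerSeries (Fin 2) k) * hw'

/-- A composite S_ψ → S_χ → S_ψ with χ ≠ ψ is multiplication by hh', where h has the nonzero weight
χ - ψ and so no constant term. Such composites are killed by ε. -/
theorem splitsOff_pi_weightPart (ha : Nat.Coprime a n) {ψ : ZMod n}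
    {ε : Module.End (weightRing k n a) (weightPart k n a ψ) →+* k}
    (hε : ∀ (φ : Module.End (weightRing k n a) (weightPart k n a ψ)) (h : MvPowerSeries (Fin 2) k),
      (∀ s, (φ s : MvPowerSeries (Fin 2) k) = s * h) → ε φ = constantCoeff h)
    {T : Type*} [Fintype T] [DecidableEq T] (χ : T → ZMod n) :
    SplitsOff (R := weightRing k n a) (M := weightPart k n a ψ) ε
      (∀ t, weightPart k n a (χ t)) {t // χ t = ψ} := by
  let i : ({t // χ t = ψ} → weightPart k n a ψ) →ₗ[weightRing k n a] ∀ t, weightPart k n a (χ t) :=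
    LinearMap.pi fun t => if h : χ t = ψ then
      (LinearEquiv.ofEq _ _ (congrArg (weightPart k n a) h.symm)).toLinearMap ∘ₗ
        LinearMap.proj (⟨t, h⟩ : {t // χ t = ψ}) else 0
  let p : (∀ t, weightPart k n a (χ t)) →ₗ[weightRing k n a] {t // χ t = ψ} → weightPart k n a ψ :=
    LinearMap.pi fun t =>
      (LinearEquiv.ofEq _ _ (congrArg (weightPart k n a) t.2)).toLinearMap ∘ₗ LinearMap.proj t.1
  have hp : ∀ x t, (p x t : MvPowerSeries (Fin 2) k) = x t.1 := fun x t => rfl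
  have hi : ∀ x t (h : χ t = ψ), (i x t : MvPowerSeries (Fin 2) k) = x ⟨t, h⟩ := fun x t h => by
    simp only [i, LinearMap.pi_apply, dif_pos h]
    rfl
  have hi0 : ∀ x t, χ t ≠ ψ → i x t = 0 := fun x t h => by
    simp only [i, LinearMap.pi_apply, dif_neg h]
    rfl
  -- The complementary idempotent projects onto the summands of weight different from ψ.
  have hid : ∀ x, x - i (p x) =
      ∑ t ∈ Finset.univ.filter fun t => χ t ≠ ψ, Pi.single t (x t) := by
    refine fun x => funext fun t => ?_
    rw [Finset.sum_apply]
    by_cases h : χ t = ψ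
    · rw [Finset.sum_eq_zero]
      · apply Subtype.ext
        change (x t : MvPowerSeries (Fin 2) k) - (i (p x) t : MvPowerSeries (Fin 2) k) = 0
        rw [hi _ _ h, hp, sub_self]
      · intro t' ht'
        have : t ≠ t' := by
          rintro rfl
          exact (Finset.mem_filter.1 ht').2 h
        simp [this]
    · rw [Finset.sum_eq_single t]
      · rw [Pi.single_eq_same, Pi.sub_apply, hi0 _ _ h]
        exact sub_zero (x t)
      · intro t' _ ht'
        simp [ht'.symm]
      · intro ht
        simp [h] at ht
  refine ⟨i, p, ?_, fun f g => ?_⟩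
  · refine LinearMap.ext fun x => funext fun t => Subtype.ext ?_
    change (p (i x) t : MvPowerSeries (Fin 2) k) = x t
    rw [hp, hi _ _ t.2]
  · refine (congrArg ε (LinearMap.ext (g := ∑ t ∈ Finset.univ.filter fun t => χ t ≠ ψ,
        (g ∘ₗ LinearMap.single (weightRing k n a) (fun t => weightPart k n a (χ t)) t) ∘ₗ
          (LinearMap.proj t ∘ₗ f)) fun s => ?_)).trans ?_
    · change g (f s - i (p (f s))) = _
      rw [hid, map_sum, LinearMap.sum_apply]
      rfl
    rw [map_sum]
    refine Finset.sum_eq_zero fun t ht => ?_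
    have hχ := (Finset.mem_filter.1 ht).2
    obtain ⟨h, hh⟩ := exists_linearMap_eq ha ((weightPart k n a (χ t)).subtype ∘ₗ
      LinearMap.proj t ∘ₗ f)
    obtain ⟨h', hh'⟩ := exists_linearMap_eq ha ((weightPart k n a ψ).subtype ∘ₗ
      g ∘ₗ LinearMap.single (weightRing k n a) (fun t => weightPart k n a (χ t)) t)
    have hmem : h ∈ weightPart k n a (χ t - ψ) := by
      refine mem_weightPart_of_forall_prod_mul_mem (χ := fun _ : Fin 1 => ψ) fun s => ?_
      rw [Fin.prod_univ_one, ← hh]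
      simp
    rw [hε _ (h * h'), map_mul,
      constantCoeff_eq_zero_of_mem_weightPart (sub_ne_zero.2 hχ) hmem, zero_mul]
    intro s
    refine (hh' (f s t)).trans ?_
    rw [show (f s t : MvPowerSeries (Fin 2) k) = s * h from hh s, mul_assoc]

theorem isMultiplicity_iff (ha : Nat.Coprime a n) {ψ : ZMod n} {T : Type*} [Fintype T]
    [DecidableEq T] {χ : T → ZMod n} {M X : Type*} [AddCommGroup M] [Module (weightRing k n a) M]
    [AddCommGroup X] [Module (weightRing k n a) X]
    (eM : M ≃ₗ[weightRing k n a] weightPart k n a ψ)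
    (eX : X ≃ₗ[weightRing k n a] ∀ t, weightPart k n a (χ t)) (b : ℕ) :
    IsMultiplicity (weightRing k n a) M X b ↔ b = Fintype.card {t // χ t = ψ} := by
  obtain ⟨ε, hε, hunit⟩ := exists_character (k := k) ha ψ
  refine SplitsOff.isMultiplicity_iff (fun φ hφ => ?_)
    ((splitsOff_pi_weightPart ha hε χ).congr eX.symm eM (Equiv.refl _)) b
  exact (MulEquiv.isUnit_map eM.conjRingEquiv).1 (hunit _ hφ)

theorem freeRank_eq (ha : Nat.Coprime a n) {T : Type*} [Fintype T]
    [DecidableEq T] {χ : T → ZMod n} {X : Type*} [AddCommGroup X] [Module (weightRing k n a) X]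
    (eX : X ≃ₗ[weightRing k n a] ∀ t, weightPart k n a (χ t)) :
    freeRank (weightRing k n a) X = Fintype.card {t // χ t = 0} := by
  obtain ⟨ε, hε, -⟩ := exists_character (k := k) ha 0
  exact ((splitsOff_pi_weightPart ha hε χ).congr eX.symm (weightPartZeroEquiv k n a).symm
    (Equiv.refl _)).freeRank_eq

/-- Mutual embeddings between each piece and R compare X with a free module on T. -/
theorem rank_eq [IsDomain (weightRing k n a)] {T : Type*} [Fintype T] {χ : T → ZMod n} {X : Type*}
    [AddCommGroup X] [Module (weightRing k n a) X]
    (eX : X ≃ₗ[weightRing k n a] ∀ t, weightPart k n a (χ t)) :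
    rank (weightRing k n a) X = Fintype.card T := by
  have h1 : rank (weightRing k n a) X = Module.finrank (weightRing k n a) X := by
    rw [rank, IsLocalization.finrank_eq (FractionRing (weightRing k n a))
      (nonZeroDivisors (weightRing k n a)) le_rfl,
      IsLocalizedModule.finrank_eq (nonZeroDivisors (weightRing k n a))
        (LocalizedModule.mkLinearMap (nonZeroDivisors (weightRing k n a)) X) le_rfl]
  rw [h1, eX.finrank_eq]
  choose φ hφ using fun t => exists_injective_weightPart (k := k) (a := a) (χ t) 0
  choose θ hθ using fun t => exists_injective_weightPart (k := k) (a := a) 0 (χ t)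
  have e0 := weightPartZeroEquiv k n a
  have hT : Module.finrank (weightRing k n a) (T → weightPart k n a 0) = Fintype.card T := by
    rw [(LinearEquiv.piCongrRight fun _ : T => e0).finrank_eq, Module.finrank_pi]
  rw [← hT]
  refine le_antisymm (LinearMap.finrank_le_finrank_of_injective
      (f := LinearMap.pi fun t => φ t ∘ₗ LinearMap.proj t) ?_)
    (LinearMap.finrank_le_finrank_of_injective
      (f := LinearMap.pi fun t => θ t ∘ₗ LinearMap.proj t) ?_)
  · exact fun x y h => funext fun t => hφ t (congrFun h t)
  · exact fun x y h => funext fun t => hθ t (congrFun h t)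

end WeightParts

/-! ### Reflexive symmetric powers -/

section SymmetricPower

variable {R ι : Type u} [CommRing R] {M : Type v} [AddCommGroup M] [Module R M]
  {N : Type w} [AddCommGroup N] [Module R N]

/-- The linear map on the symmetric power that is given by a symmetric multilinear map. -/
def symmetricPowerLift (f : MultilinearMap R (fun _ : ι => M) N)
    (hf : ∀ (σ : Equiv.Perm ι) (x : ι → M), f (fun i => x (σ i)) = f x) :
    SymmetricPower R ι M →ₗ[R] N where
  toFun := AddCon.lift _ (PiTensorProduct.lift f).toAddMonoidHom (AddCon.addConGen_le.2 (by
    rintro _ _ ⟨σ, x⟩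
    refine AddCon.ker_apply.2 ?_
    rw [LinearMap.toAddMonoidHom_coe, PiTensorProduct.lift.tprod, PiTensorProduct.lift.tprod]
    exact (hf σ x).symm))
  map_add' := map_add _
  map_smul' r x := AddCon.induction_on x fun x => (PiTensorProduct.lift f).map_smul r x

theorem symmetricPowerLift_tprod (f : MultilinearMap R (fun _ : ι => M) N)
    (hf : ∀ (σ : Equiv.Perm ι) (x : ι → M), f (fun i => x (σ i)) = f x) (x : ι → M) :
    symmetricPowerLift f hf (SymmetricPower.tprod R x) = f x :=
  PiTensorProduct.lift.tprod x

end SymmetricPower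

/-! ### Duals of direct sums of weight parts and of their symmetric powers -/

section Dual

variable {k : Type u} [Field k] {n a : ℕ} [NeZero n]

/-- O is the set of orbits of index families r under permutations. A functional restricted to
tensors of pure type r is multiplication of the product by some H(r) of weight -∑ χ(rᵢ), and
symmetry makes H constant on orbits. Conversely, h defines a symmetric form by summing over all
families r; on tensors of pure type r only the term of r survives, so no factorials appear and the
characteristic is irrelevant. -/
theorem dual_symmetricPower_equiv (ha : Nat.Coprime a n) {ι : Type u} [Fintype ι] [DecidableEq ι]
    {T O : Type*} [Fintype T] [DecidableEq T] {χ : T → ZMod n} {L : Type v} [AddCommGroup L]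
    [Module (weightRing k n a) L] (e : L ≃ₗ[weightRing k n a] ∀ t, weightPart k n a (χ t))
    (o : (ι → T) → O) (ho : Function.Surjective o)
    (hperm : ∀ r (σ : Equiv.Perm ι), o (fun i => r (σ i)) = o r)
    (horb : ∀ r r', o r = o r' → ∃ σ : Equiv.Perm ι, ∀ i, r i = r' (σ i))
    (ψ : O → ZMod n) (hψ : ∀ r, ψ (o r) = ∑ i, χ (r i)) :
    Nonempty (Module.Dual (weightRing k n a) (SymmetricPower (weightRing k n a) ι L) ≃ₗ[weightRing k n a]
      ∀ m : O, weightPart k n a (-ψ m)) := by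
  let coord (r : ι → T) (i : ι) : L →ₗ[weightRing k n a] MvPowerSeries (Fin 2) k :=
    (weightPart k n a (χ (r i))).subtype ∘ₗ LinearMap.proj (r i) ∘ₗ e.toLinearMap
  have hcoord : ∀ r i x, coord r i x = e x (r i) := fun r i x => rfl
  let F (h : ∀ m : O, weightPart k n a (-ψ m)) :
      MultilinearMap (weightRing k n a) (fun _ : ι => L) (MvPowerSeries (Fin 2) k) :=
    ∑ r : ι → T, (LinearMap.mulLeft (weightRing k n a)
      (h (o r) : MvPowerSeries (Fin 2) k)).compMultilinearMap
        ((MultilinearMap.mkPiAlgebra (weightRing k n a) ι (MvPowerSeries (Fin 2) k)).compLinearMap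
          (coord r))
  have hF : ∀ h x, F h x = ∑ r : ι → T, (h (o r) : MvPowerSeries (Fin 2) k) *
      ∏ i, (e (x i) (r i) : MvPowerSeries (Fin 2) k) := by
    intro h x
    simp [F, hcoord]
  have hF0 : ∀ h x, F h x ∈ weightPart k n a 0 := by
    intro h x
    rw [hF]
    refine sum_mem fun r _ => ?_
    have := mul_mem_weightPart (h (o r)).2
      (prod_mem_weightPart Finset.univ fun i _ => (e (x i) (r i)).2)
    have h0 : -ψ (o r) + ∑ i, χ (r i) = 0 := by rw [hψ, neg_add_cancel]
    rwa [h0] at this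
  let G (h : ∀ m : O, weightPart k n a (-ψ m)) :
      MultilinearMap (weightRing k n a) (fun _ : ι => L) (weightRing k n a) :=
    (weightPartZeroEquiv k n a).toLinearMap.compMultilinearMap
      ((F h).codRestrict (weightPart k n a 0) (hF0 h))
  have hG : ∀ h x, (G h x : MvPowerSeries (Fin 2) k) = F h x := fun h x => rfl
  have hGsymm : ∀ h (σ : Equiv.Perm ι) (x : ι → L), G h (fun i => x (σ i)) = G h x := by
    intro h σ x
    apply Subtype.ext
    rw [hG, hG, hF, hF]
    let A : (ι → T) ≃ (ι → T) := Equiv.arrowCongr σ (Equiv.refl T)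
    have hA : ∀ r i, A r (σ i) = r i := fun r i => congrArg r (σ.symm_apply_apply i)
    refine Fintype.sum_equiv A _ _ fun r => ?_
    congr 1
    · have h1 : o r = o (A r) :=
        (congrArg o (funext fun i => (hA r i).symm)).trans (hperm (A r) σ)
      rw [h1]
    · refine Fintype.prod_equiv σ _ _ fun i => ?_
      rw [hA]
  have hLext : ∀ {f g : SymmetricPower (weightRing k n a) ι L →ₗ[weightRing k n a] weightRing k n a},
      (∀ x : ι → L, f (SymmetricPower.tprod _ x) = g (SymmetricPower.tprod _ x)) → f = g :=
    fun h => LinearMap.ext_on_range (SymmetricPower.span_tprod_eq_top _ _ _) h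
  let Ψ : (∀ m : O, weightPart k n a (-ψ m)) →ₗ[weightRing k n a]
      Module.Dual (weightRing k n a) (SymmetricPower (weightRing k n a) ι L) :=
    { toFun h := symmetricPowerLift (G h) (hGsymm h)
      map_add' h h' := by
        refine hLext fun x => ?_
        rw [LinearMap.add_apply, symmetricPowerLift_tprod, symmetricPowerLift_tprod,
          symmetricPowerLift_tprod]
        apply Subtype.ext
        rw [Subalgebra.coe_add, hG, hG, hG, hF, hF, hF, ← Finset.sum_add_distrib]
        refine Finset.sum_congr rfl fun r _ => ?_
        rw [Pi.add_apply, Submodule.coe_add, add_mul]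
      map_smul' c h := by
        refine hLext fun x => ?_
        rw [RingHom.id_apply, LinearMap.smul_apply, symmetricPowerLift_tprod,
          symmetricPowerLift_tprod]
        apply Subtype.ext
        rw [smul_eq_mul, Subalgebra.coe_mul, hG, hG, hF, hF, Finset.mul_sum]
        refine Finset.sum_congr rfl fun r _ => ?_
        rw [Pi.smul_apply, Submodule.coe_smul, Subalgebra.smul_def, smul_eq_mul, mul_assoc] }
  have hΨ : ∀ h x, (Ψ h (SymmetricPower.tprod _ x) : MvPowerSeries (Fin 2) k) =
      ∑ r : ι → T, (h (o r) : MvPowerSeries (Fin 2) k) *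
        ∏ i, (e (x i) (r i) : MvPowerSeries (Fin 2) k) := fun h x => by
    rw [← hF, ← hG]
    exact congrArg Subtype.val (symmetricPowerLift_tprod (G h) (hGsymm h) x)
  let sg (t : T) : weightPart k n a (χ t) →ₗ[weightRing k n a] L :=
    e.symm.toLinearMap ∘ₗ LinearMap.single _ (fun t => weightPart k n a (χ t)) t
  have hsg : ∀ t s, e (sg t s) = Pi.single t s := fun t s => by simp [sg]
  have hpure : ∀ h (r : ι → T) (s : ∀ i, weightPart k n a (χ (r i))),
      (Ψ h (SymmetricPower.tprod _ fun i => sg (r i) (s i)) : MvPowerSeries (Fin 2) k) =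
        (∏ i, (s i : MvPowerSeries (Fin 2) k)) * h (o r) := by
    intro h r s
    rw [hΨ, Finset.sum_eq_single r]
    · rw [mul_comm]
      simp [hsg]
    · intro r' _ hr'
      obtain ⟨i, hi⟩ := Function.ne_iff.1 hr'
      rw [Finset.prod_eq_zero (Finset.mem_univ i), mul_zero]
      rw [hsg, Pi.single_eq_of_ne hi, Submodule.coe_zero]
    · simp
  refine ⟨(LinearEquiv.ofBijective Ψ ⟨fun h h' hh => funext fun m => Subtype.ext ?_,
    fun l => ?_⟩).symm⟩
  · obtain ⟨r, rfl⟩ := ho m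
    refine eq_of_forall_prod_mul_eq (a := a) (fun i => χ (r i)) fun s => ?_
    rw [← hpure, ← hpure, hh]
  · let lr (r : ι → T) : MultilinearMap (weightRing k n a) (fun i => weightPart k n a (χ (r i)))
        (MvPowerSeries (Fin 2) k) :=
      ((Algebra.linearMap (weightRing k n a) (MvPowerSeries (Fin 2) k)) ∘ₗ l).compMultilinearMap
        ((SymmetricPower.tprod (weightRing k n a)).compLinearMap fun i => sg (r i))
    have hlr : ∀ r s, lr r s = (l (SymmetricPower.tprod _ fun i => sg (r i) (s i)) :
      MvPowerSeries (Fin 2) k) := fun r s => rfl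
    choose H hH using fun r => exists_multilinearMap_eq ha (lr r)
    have hHmem : ∀ r, H r ∈ weightPart k n a (-ψ (o r)) := by
      intro r
      refine mem_weightPart_of_forall_prod_mul_mem (χ := fun i => χ (r i)) fun s => ?_
      rw [← hH, hlr, hψ, add_neg_cancel]
      exact (l _).2
    have hHσ : ∀ (r r' : ι → T) (σ : Equiv.Perm ι), (∀ i, r i = r' (σ i)) → H r = H r' := by
      intro r r' σ hσ
      obtain rfl : r = fun i => r' (σ i) := funext hσ
      refine eq_of_forall_prod_mul_eq (a := a) (fun i => χ (r' i)) fun s => ?_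
      rw [← hH, hlr, ← SymmetricPower.tprod_equiv σ, ← hlr (fun i => r' (σ i)) (fun i => s (σ i)),
        hH]
      congr 1
      exact (Fintype.prod_equiv σ _ _ fun i => rfl).symm
    -- Any representative of an orbit serves, as H is invariant under permutations.
    choose rep hrep using ho
    have hHrep : ∀ r, H (rep (o r)) = H r := fun r => by
      obtain ⟨σ, hσ⟩ := horb _ _ (hrep (o r))
      exact hHσ _ _ σ hσ
    refine ⟨fun m => ⟨H (rep m), by
      have := hHmem (rep m)
      rwa [hrep] at this⟩, hLext fun x => Subtype.ext ?_⟩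
    rw [hΨ]
    have hx : x = fun i => ∑ t, sg t (e (x i) t) := funext fun i => by
      apply e.injective
      rw [map_sum]
      simp only [hsg]
      exact (Finset.univ_sum_single _).symm
    conv_rhs => rw [hx, MultilinearMap.map_sum, map_sum]
    rw [AddSubmonoidClass.coe_finsetSum]
    refine Finset.sum_congr rfl fun r _ => ?_
    rw [← hlr, hH, mul_comm]
    congr 1
    exact hHrep r

theorem dual_pi_weightPart_equiv (ha : Nat.Coprime a n) {T : Type*} [Fintype T] [DecidableEq T]
    {χ ψ : T → ZMod n} (h : ∀ t, ψ t = -χ t) :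
    Nonempty (Module.Dual (weightRing k n a) (∀ t, weightPart k n a (χ t)) ≃ₗ[weightRing k n a]
      ∀ t, weightPart k n a (ψ t)) := by
  obtain rfl : ψ = fun t => -χ t := funext h
  let Ψ : (∀ t, weightPart k n a (-χ t)) →ₗ[weightRing k n a]
      Module.Dual (weightRing k n a) (∀ t, weightPart k n a (χ t)) :=
    { toFun h :=
        { toFun x := ⟨∑ t, (x t : MvPowerSeries (Fin 2) k) * h t, sum_mem fun t _ => by
            have := mul_mem_weightPart (x t).2 (h t).2
            rwa [add_neg_cancel] at this⟩
          map_add' x y := Subtype.ext (by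
            simp [add_mul, Finset.sum_add_distrib])
          map_smul' c x := Subtype.ext (by
            simp [Finset.mul_sum, Subalgebra.smul_def, mul_assoc]) }
      map_add' h h' := LinearMap.ext fun x => Subtype.ext (by
        simp [mul_add, Finset.sum_add_distrib])
      map_smul' c h := LinearMap.ext fun x => Subtype.ext (by
        simp [Finset.mul_sum, Subalgebra.smul_def, mul_left_comm]) }
  have hΨ : ∀ h x, (Ψ h x : MvPowerSeries (Fin 2) k) =
    ∑ t, (x t : MvPowerSeries (Fin 2) k) * h t := fun h x => rfl
  have hpure : ∀ h t s, (Ψ h (Pi.single t s) : MvPowerSeries (Fin 2) k) = s * h t := by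
    intro h t s
    rw [hΨ, Finset.sum_eq_single t]
    · rw [Pi.single_eq_same]
    · intro t' _ ht'
      rw [Pi.single_eq_of_ne ht', Submodule.coe_zero, zero_mul]
    · simp
  refine ⟨(LinearEquiv.ofBijective Ψ ⟨fun h h' hh => funext fun t => Subtype.ext ?_,
    fun l => ?_⟩).symm⟩
  · refine eq_of_forall_prod_mul_eq (n := n) (a := a) (fun _ : Fin 1 => χ t) fun s => ?_
    rw [Fin.prod_univ_one, ← hpure, ← hpure, hh]
  · choose H hH using fun t => exists_linearMap_eq ha
      ((Algebra.linearMap (weightRing k n a) (MvPowerSeries (Fin 2) k)) ∘ₗ l ∘ₗ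
        LinearMap.single _ (fun t => weightPart k n a (χ t)) t)
    have hH' : ∀ t s, (l (Pi.single t s) : MvPowerSeries (Fin 2) k) = s * H t := hH
    refine ⟨fun t => ⟨H t, ?_⟩, ?_⟩
    · refine mem_weightPart_of_forall_prod_mul_mem (χ := fun _ : Fin 1 => χ t) fun s => ?_
      rw [Fin.prod_univ_one, ← hH', Fin.sum_univ_one, add_neg_cancel]
      exact (l (Pi.single t (s 0))).2
    · refine LinearMap.pi_ext fun t s => Subtype.ext ?_
      rw [hpure, hH']

omit [NeZero n] in
-- Equal multisets of values mean equally large fibres; bijections between the fibres glue to a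
-- permutation.
theorem exists_perm_of_map_univ_eq {ι T : Type*} [Fintype ι] [DecidableEq T]
    {r r' : ι → T} (h : Finset.univ.val.map r = Finset.univ.val.map r') :
    ∃ σ : Equiv.Perm ι, ∀ i, r i = r' (σ i) := by
  have hcard : ∀ t, Fintype.card {i // r i = t} = Fintype.card {i // r' i = t} := by
    intro t
    have := congrArg (Multiset.count t) h
    rw [Multiset.count_map, Multiset.count_map] at this
    simp only [Fintype.card_subtype, eq_comm (b := t)]
    exact this
  refine ⟨Equiv.ofFiberEquiv fun t => Fintype.equivOfCardEq (hcard t), fun i => ?_⟩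
  exact (Equiv.ofFiberEquiv_map _ i).symm

/-- Orbits of index families of length q are multisets of size q. The first dual negates the weights
and the second restores them. -/
theorem reflexiveSymmetricPower_equiv (ha : Nat.Coprime a n) (q : ℕ)
    {T : Type*} [Fintype T] [DecidableEq T] {χ : T → ZMod n} {L : Type v} [AddCommGroup L]
    [Module (weightRing k n a) L] (e : L ≃ₗ[weightRing k n a] ∀ t, weightPart k n a (χ t)) :
    Nonempty (ReflexiveSymmetricPower (weightRing k n a) q L ≃ₗ[weightRing k n a]
      ∀ m : Sym T q, weightPart k n a ((m : Multiset T).map χ).sum) := by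
  obtain ⟨e₁⟩ := dual_symmetricPower_equiv ha (ι := ULift.{u} (Fin q)) e
    (O := Sym T q) (fun r => ⟨Finset.univ.val.map r, by simp⟩)
    (fun m => by
      obtain ⟨l, hl⟩ := Quot.exists_rep (m : Multiset T)
      have hlen : l.length = q := by
        have := m.2
        rw [← Multiset.coe_card, ← this]
        exact congrArg Multiset.card hl
      subst hlen
      refine ⟨fun i => l.get i.down, Subtype.ext ?_⟩
      change Finset.univ.val.map (l.get ∘ Equiv.ulift) = _
      rw [← Multiset.map_map, Multiset.map_univ_val_equiv, Fin.univ_val_map, List.ofFn_get]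
      exact hl)
    (fun r σ => Subtype.ext (by
      change Finset.univ.val.map (r ∘ σ) = _
      rw [← Multiset.map_map, Multiset.map_univ_val_equiv]))
    (fun r r' h => exists_perm_of_map_univ_eq (congrArg Subtype.val h))
    (fun m => ((m : Multiset T).map χ).sum)
    (fun r => congrArg Multiset.sum (Multiset.map_map χ r Finset.univ.val))
  obtain ⟨e₂⟩ := dual_pi_weightPart_equiv (k := k) ha
    fun m : Sym T q => (neg_neg ((m : Multiset T).map χ).sum).symm
  exact ⟨e₁.symm.dualMap ≪≫ₗ e₂⟩

end Dual

/-! ### The second syzygy module of the residue field -/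

section Syzygies

/-- The residue field is cyclic, so its minimal generating set is a single nonzero element c, with
annihilator the maximal ideal. -/
theorem exists_injective_syzygy_one (R : Type u) [CommRing R] [IsLocalRing R] :
    ∃ f : syzygy R 1 (ModuleCat.of R (IsLocalRing.ResidueField R)) →ₗ[R] R,
      Function.Injective f ∧ LinearMap.range f = IsLocalRing.maximalIdeal R := by
  have htop : (⊤ : Submodule R (IsLocalRing.ResidueField R)) = Submodule.span R {1} := by
    refine (eq_top_iff.2 fun x _ => ?_).symm
    obtain ⟨r, rfl⟩ := IsLocalRing.residue_surjective x
    refine Submodule.mem_span_singleton.2 ⟨r, ?_⟩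
    rw [Algebra.smul_def, mul_one]
    rfl
  have hfg : (⊤ : Submodule R (IsLocalRing.ResidueField R)).FG := htop ▸ Submodule.fg_span_singleton 1
  obtain ⟨c, hc⟩ : ∃ c, (⊤ : Submodule R (IsLocalRing.ResidueField R)).generators = {c} := by
    rw [← Set.ncard_eq_one, hfg.generators_ncard]
    nth_rw 1 [htop]
    exact Submodule.spanFinrank_singleton one_ne_zero
  have hc0 : c ≠ 0 := by
    rintro rfl
    have := (⊤ : Submodule R (IsLocalRing.ResidueField R)).span_generators
    rw [hc, Submodule.span_zero_singleton] at this
    exact bot_ne_top this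
  let c' : (⊤ : Submodule R (IsLocalRing.ResidueField R)).generators := ⟨c, by rw [hc]; rfl⟩
  have hall : ∀ x : (⊤ : Submodule R (IsLocalRing.ResidueField R)).generators, x = c' := fun x =>
    Subtype.ext (hc.subset x.2)
  have hker : ∀ f : (⊤ : Submodule R (IsLocalRing.ResidueField R)).generators →₀ R,
      f ∈ LinearMap.ker (minimalCover R (IsLocalRing.ResidueField R)) ↔
        f c' ∈ IsLocalRing.maximalIdeal R := by
    intro f
    have hf : f = Finsupp.single c' (f c') := by
      ext x
      rw [hall x, Finsupp.single_eq_same]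
    rw [LinearMap.mem_ker, hf, minimalCover, Finsupp.linearCombination_single,
      Finsupp.single_eq_same, Algebra.smul_def, mul_eq_zero, or_iff_left hc0]
    exact IsLocalRing.residue_eq_zero_iff _
  refine ⟨Finsupp.lapply c' ∘ₗ
    (LinearMap.ker (minimalCover R (IsLocalRing.ResidueField R))).subtype, ?_, ?_⟩
  · intro f g hfg
    apply Subtype.ext
    ext x
    rw [hall x]
    exact hfg
  · ext r
    constructor
    · rintro ⟨f, rfl⟩
      exact (hker f.1).1 f.2
    · intro hr
      have hmem : Finsupp.single c' r ∈
          LinearMap.ker (minimalCover R (IsLocalRing.ResidueField R)) :=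
        (hker _).2 (by rwa [Finsupp.single_eq_same])
      exact ⟨⟨Finsupp.single c' r, hmem⟩, Finsupp.single_eq_same⟩

theorem exists_equiv_syzygy_two (R : Type u) [CommRing R] [IsLocalRing R] [IsNoetherianRing R] :
    ∃ (G : Type u) (_ : Fintype G) (g : G → R),
      Submodule.span R (Set.range g) = IsLocalRing.maximalIdeal R ∧
      Nonempty (syzygy R 2 (ModuleCat.of R (IsLocalRing.ResidueField R)) ≃ₗ[R]
        LinearMap.ker (Fintype.linearCombination R g)) := by
  obtain ⟨f, hf, hrange⟩ := exists_injective_syzygy_one R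
  let Z := syzygy R 1 (ModuleCat.of R (IsLocalRing.ResidueField R))
  have : Module.Finite R Z := Module.Finite.of_injective f hf
  have hfin : (⊤ : Submodule R Z).generators.Finite := Module.Finite.fg_top.finite_generators
  let G := (⊤ : Submodule R Z).generators
  let _ : Fintype G := hfin.fintype
  refine ⟨G, inferInstance, fun s => f s.1, ?_, ⟨?_⟩⟩
  · rw [← hrange, LinearMap.range_eq_map, ← (⊤ : Submodule R Z).span_generators,
      Submodule.map_span, Set.image_eq_range]
  · refine (Finsupp.linearEquivFunOnFinite R R G).submoduleMap
      (LinearMap.ker (minimalCover R Z)) ≪≫ₗ LinearEquiv.ofEq _ _ ?_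
    ext h
    have key : ∀ h' : G →₀ R, Fintype.linearCombination R (fun s : G => f s.1) h' =
        f (minimalCover R Z h') := by
      intro h'
      rw [minimalCover, Finsupp.linearCombination_apply, Finsupp.sum_fintype _ _ (by simp),
        map_sum, Fintype.linearCombination_apply]
      exact Finset.sum_congr rfl fun s _ => (map_smul f (h' s) s.1).symm
    constructor
    · rintro ⟨h', hh', rfl⟩
      rw [SetLike.mem_coe, LinearMap.mem_ker] at hh'
      rw [LinearMap.mem_ker]
      exact (key h').trans (by rw [hh', map_zero])
    · intro hh
      refine ⟨(Finsupp.linearEquivFunOnFinite R R G).symm h, ?_, LinearEquiv.apply_symm_apply _ _⟩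
      rw [SetLike.mem_coe, LinearMap.mem_ker]
      apply hf
      rw [← key, map_zero]
      exact hh

end Syzygies

/-! ### Relations over k[[u,v]] and a summand of unit weight in the second syzygy -/

section Relations

variable {k : Type u} [Field k] {n a : ℕ} [NeZero n] {G : Type*} [Fintype G]
  (g : G → weightRing k n a)

/-- The relations over `k[[u, v]]` between power series of weight zero. -/
def relations : Submodule (MvPowerSeries (Fin 2) k) (G → MvPowerSeries (Fin 2) k) :=
  LinearMap.ker (Fintype.linearCombination (MvPowerSeries (Fin 2) k)
    fun s => (g s : MvPowerSeries (Fin 2) k))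

omit [NeZero n] in
variable {g} in
theorem mem_relations {h : G → MvPowerSeries (Fin 2) k} :
    h ∈ relations g ↔ ∑ s, h s * g s = 0 := by
  rw [relations, LinearMap.mem_ker, Fintype.linearCombination_apply]
  rfl

/-- The grading of the module of relations. -/
def relationsGrading : WeightGrading k n a (relations g) where
  proj χ :=
    { toFun h := ⟨fun s => weightProj k n a χ (h.1 s), by
        have h0 := congrArg (weightProj k n a χ) (mem_relations.1 h.2)
        rw [map_zero, map_sum] at h0
        rw [mem_relations, ← h0]
        refine Finset.sum_congr rfl fun s _ => ?_
        have := weightProj_mul (ψ := χ) (mem_weightRing.1 (g s).2) (h.1 s)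
        rw [zero_add] at this
        rw [mul_comm (h.1 s), this, mul_comm]⟩
      map_zero' := Subtype.ext (funext fun s => map_zero _)
      map_add' h h' := Subtype.ext (funext fun s => map_add _ _ _) }
  sum_proj h := by
    apply Subtype.ext
    rw [AddSubmonoidClass.coe_finsetSum]
    funext s
    rw [Finset.sum_apply]
    exact sum_weightProj _
  proj_proj χ h := Subtype.ext (funext fun s => weightProj_of_mem (weightProj_mem _ _))
  proj_proj_of_ne χ ψ hne h :=
    Subtype.ext (funext fun s => weightProj_of_mem_of_ne hne (weightProj_mem _ _))
  proj_smul χ ψ c hc h := Subtype.ext (funext fun s => weightProj_mul hc _)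

theorem proj_relationsGrading (χ : ZMod n) (h : relations g) (s : G) :
    ((relationsGrading g).proj χ h).1 s = weightProj k n a χ (h.1 s) := rfl

/-- The relations over the base ring are the relations of degree zero. -/
def relationsZeroPartEquiv : LinearMap.ker (Fintype.linearCombination (weightRing k n a) g)
    ≃ₗ[weightRing k n a] (relationsGrading g).zeroPart where
  toFun h := ⟨⟨fun s => h.1 s, by
      have := h.2
      rw [LinearMap.mem_ker, Fintype.linearCombination_apply] at this
      have := congrArg Subtype.val this
      rw [AddSubmonoidClass.coe_finsetSum] at this
      exact mem_relations.2 this⟩,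
    Subtype.ext (funext fun s => weightProj_of_mem (h.1 s).2)⟩
  map_add' _ _ := rfl
  map_smul' _ _ := rfl
  invFun h := ⟨fun s => ⟨h.1.1 s, by
      have : weightProj k n a 0 (h.1.1 s) = h.1.1 s := congrFun (congrArg Subtype.val h.2) s
      rw [← this]
      exact weightProj_mem _ _⟩, by
    rw [LinearMap.mem_ker, Fintype.linearCombination_apply]
    apply Subtype.ext
    rw [AddSubmonoidClass.coe_finsetSum]
    exact mem_relations.1 h.1.2⟩
  left_inv _ := rfl
  right_inv _ := rfl

variable {g}

omit [NeZero n] in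
theorem eq_zero_of_X_zero_smul_relations (h : relations g)
    (hh : (X 0 : MvPowerSeries (Fin 2) k) • h = 0) : h = 0 := by
  apply Subtype.ext
  funext s
  have := congrFun (congrArg Subtype.val hh) s
  exact (mul_eq_zero.1 this).resolve_left (X_ne_zero k 0)

omit [NeZero n] in
-- Divisibility by u is tested coordinatewise, where u and v are coprime, and a relation divided by
-- u is still a relation.
theorem exists_eq_X_zero_smul_relations (h h' : relations g)
    (hh : (X 1 : MvPowerSeries (Fin 2) k) • h = (X 0 : MvPowerSeries (Fin 2) k) • h') :
    ∃ z, h = (X 0 : MvPowerSeries (Fin 2) k) • z := by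
  have hdvd : ∀ s, (X 0 : MvPowerSeries (Fin 2) k) ∣ h.1 s := fun s => by
    have h1 : X 1 * h.1 s = X 0 * h'.1 s := congrFun (congrArg Subtype.val hh) s
    have := X_pow_dvd_of_dvd_X_pow_mul (k := k) (s := 0) (t := 1) (by decide) (i := 1) (j := 1)
      (f := h.1 s) ⟨h'.1 s, by simpa using h1⟩
    simpa using this
  choose z hz using hdvd
  refine ⟨⟨z, ?_⟩, Subtype.ext (funext hz)⟩
  rw [mem_relations]
  apply mul_left_cancel₀ (X_ne_zero k 0)
  rw [mul_zero, ← mem_relations.1 h.2, Finset.mul_sum]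
  exact Finset.sum_congr rfl fun s _ => by rw [hz s, mul_assoc]

omit [NeZero n] in
-- The only pure powers of u in R are those of uⁿ, so a product cr involves no uʲ with j < n.
theorem coeff_mul_eq_zero_of_lt (c : MvPowerSeries (Fin 2) k) {r : weightRing k n a}
    (hr : constantCoeff (r : MvPowerSeries (Fin 2) k) = 0) {j : ℕ} (hj : j < n) :
    coeff (Finsupp.single 0 j) (c * (r : MvPowerSeries (Fin 2) k)) = 0 := by
  classical
  rw [coeff_mul]
  refine Finset.sum_eq_zero fun p hp => ?_
  by_contra hne
  have hw := r.2 p.2 (right_ne_zero_of_mul hne)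
  rw [Finset.HasAntidiagonal.mem_antidiagonal] at hp
  have h0 : p.2 0 ≤ j := by
    have := DFunLike.congr_fun hp 0
    simp at this
    omega
  have h1 : p.2 1 = 0 := by
    have := DFunLike.congr_fun hp 1
    simp at this
    omega
  rw [weight_apply, h1, Nat.cast_zero, mul_zero, add_zero, ZMod.natCast_eq_zero_iff] at hw
  have h2 : p.2 0 = 0 := Nat.eq_zero_of_dvd_of_lt hw (by omega)
  have h3 : p.2 = 0 := by
    ext l
    fin_cases l
    · exact h2
    · exact h1
  apply right_ne_zero_of_mul hne
  rw [h3]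
  simpa using hr

/-- With i representing -a, both uⁿ = ∑ αg and uⁱv = ∑ βg lie in the maximal ideal of R, and v·uⁿ =
uᵐ⁺¹·uⁱv yields the relation vα - uᵐ⁺¹β of weight a. Were it ux + vy with relations x and y, then α
- y = uc, and summing against g would put uⁿ⁻¹ into the ideal of S generated by the maximal ideal of
R. -/
theorem exists_relation [IsLocalRing (weightRing k n a)]
    (hg : Submodule.span (weightRing k n a) (Set.range g) =
      IsLocalRing.maximalIdeal (weightRing k n a)) :
    ∃ z : relations g, (relationsGrading g).proj a z = z ∧
      ¬ ∃ x y : relations g, z = (X 0 : MvPowerSeries (Fin 2) k) • x +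
        (X 1 : MvPowerSeries (Fin 2) k) • y := by
  have hn := NeZero.ne n
  have hcomb : ∀ f : weightRing k n a, constantCoeff (f : MvPowerSeries (Fin 2) k) = 0 →
      ∃ c : G → weightRing k n a,
        ∑ s, (c s : MvPowerSeries (Fin 2) k) * g s = (f : MvPowerSeries (Fin 2) k) := by
    intro f hf
    obtain ⟨c, hc⟩ := (Submodule.mem_span_range_iff_exists_fun _).1
      (hg.ge (mem_maximalIdeal_weightRing.2 hf))
    refine ⟨c, ?_⟩
    rw [← hc, AddSubmonoidClass.coe_finsetSum]
    rfl
  have hgc : ∀ s, constantCoeff (g s : MvPowerSeries (Fin 2) k) = 0 := fun s =>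
    mem_maximalIdeal_weightRing.1 (hg.le (Submodule.subset_span ⟨s, rfl⟩))
  let i := (-(a : ZMod n)).val
  have hi : i < n := ZMod.val_lt _
  have hi' : (i : ZMod n) = -a := by simp [i]
  obtain ⟨m, hm⟩ : ∃ m, n = i + m + 1 := ⟨n - i - 1, by omega⟩
  have hmw : ((m + 1 : ℕ) : ZMod n) = a := by
    have : ((i + m + 1 : ℕ) : ZMod n) = 0 := by rw [← hm, ZMod.natCast_self]
    push_cast at this ⊢
    rw [hi'] at this
    linear_combination this
  obtain ⟨α, hα⟩ := hcomb ⟨X 0 ^ n, X_pow_mem_weightRing 0⟩ (by simp [hn])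
  obtain ⟨β, hβ⟩ := hcomb ⟨X 0 ^ i * X 1, by
    rw [mem_weightRing]
    have := mul_mem_weightPart (pow_mem_weightPart
      (X_zero_mem_weightPart (k := k) (n := n) (a := a)) i) X_one_mem_weightPart
    rwa [hi', mul_one, neg_add_cancel] at this⟩ (by simp)
  simp only at hα hβ
  refine ⟨⟨fun s => X 1 * (α s : MvPowerSeries (Fin 2) k) - X 0 ^ (m + 1) * (β s : MvPowerSeries (Fin 2) k), ?_⟩, ?_, ?_⟩
  · rw [mem_relations]
    have : ∑ s, (X 1 * (α s : MvPowerSeries (Fin 2) k) - X 0 ^ (m + 1) * (β s : MvPowerSeries (Fin 2) k)) *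
          (g s : MvPowerSeries (Fin 2) k) =
        X 1 * ∑ s, (α s : MvPowerSeries (Fin 2) k) * g s -
          X 0 ^ (m + 1) * ∑ s, (β s : MvPowerSeries (Fin 2) k) * g s := by
      rw [Finset.mul_sum, Finset.mul_sum, ← Finset.sum_sub_distrib]
      exact Finset.sum_congr rfl fun s _ => by ring
    rw [this, hα, hβ, hm]
    ring
  · refine Subtype.ext (funext fun s => ?_)
    rw [proj_relationsGrading]
    refine weightProj_of_mem (sub_mem ?_ ?_)
    · have := mul_mem_weightPart (X_one_mem_weightPart (k := k) (n := n) (a := a))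
        (mem_weightRing.1 (α s).2)
      rwa [add_zero] at this
    · have := mul_mem_weightPart (pow_mem_weightPart
        (X_zero_mem_weightPart (k := k) (n := n) (a := a)) (m + 1)) (mem_weightRing.1 (β s).2)
      rwa [hmw, mul_one, add_zero] at this
  · rintro ⟨x, y, hxy⟩
    have hs : ∀ s, X 1 * (α s : MvPowerSeries (Fin 2) k) - X 0 ^ (m + 1) * (β s : MvPowerSeries (Fin 2) k) =
        X 0 * x.1 s + X 1 * y.1 s := fun s => congrFun (congrArg Subtype.val hxy) s
    have hdvd : ∀ s, (X 0 : MvPowerSeries (Fin 2) k) ∣ α s - y.1 s := fun s => by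
      have := X_pow_dvd_of_dvd_X_pow_mul (k := k) (s := 0) (t := 1) (by decide) (i := 1) (j := 1)
        (f := (α s : MvPowerSeries (Fin 2) k) - y.1 s) ⟨x.1 s + X 0 ^ m * (β s : MvPowerSeries (Fin 2) k), by
          linear_combination hs s⟩
      simpa using this
    choose c hc using hdvd
    -- The exponent i + m is n - 1, just below the first pure power of u available.
    have hsum : (X 0 : MvPowerSeries (Fin 2) k) ^ (i + m) = ∑ s, c s * g s := by
      apply mul_left_cancel₀ (X_ne_zero k 0)
      have h1 : (X 0 : MvPowerSeries (Fin 2) k) * X 0 ^ (i + m) = X 0 ^ n := by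
        rw [hm]; ring
      rw [h1, ← hα, Finset.mul_sum, ← sub_zero (∑ s, (α s : MvPowerSeries (Fin 2) k) * g s),
        ← mem_relations.1 y.2, ← Finset.sum_sub_distrib]
      exact Finset.sum_congr rfl fun s _ => by rw [← mul_assoc, ← hc]; ring
    have hcoeff := congrArg (coeff (Finsupp.single 0 (i + m))) hsum
    rw [map_sum, Finset.sum_eq_zero fun s _ => coeff_mul_eq_zero_of_lt (c s) (hgc s) (by omega),
      X_pow_eq, coeff_monomial_same] at hcoeff
    exact one_ne_zero hcoeff

theorem exists_equiv_syzygy [IsLocalRing (weightRing k n a)] (ha : Nat.Coprime a n) :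
    ∃ (r : ℕ) (χ : Fin r → ZMod n),
      Nonempty (syzygy (weightRing k n a) 2 (ModuleCat.of (weightRing k n a)
        (IsLocalRing.ResidueField (weightRing k n a))) ≃ₗ[weightRing k n a]
          ∀ t, weightPart k n a (χ t)) ∧ ∃ t, IsUnit (χ t) := by
  obtain ⟨G, _, g, hg, ⟨e⟩⟩ := exists_equiv_syzygy_two (weightRing k n a)
  obtain ⟨r, b, d, hb⟩ := (relationsGrading g).exists_homogeneous_basis
    eq_zero_of_X_zero_smul_relations exists_eq_X_zero_smul_relations
  obtain ⟨z, hz, hm⟩ := exists_relation hg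
  obtain ⟨t, ht⟩ := (relationsGrading g).exists_degree_eq b hb hz hm
  refine ⟨r, fun t => -d t, ⟨e ≪≫ₗ relationsZeroPartEquiv g ≪≫ₗ
    ((relationsGrading g).zeroPartEquiv b hb).symm⟩, t, ?_⟩
  change IsUnit (-d t)
  rw [ht]
  exact ((ZMod.isUnit_iff_coprime a n).2 ha).neg

end Relations

/-! ### Equidistribution of the weights of monomials -/

section Counting

/-- The increments c(q+1, ψ+χ) - c(q, ψ) are nonnegative and sum over ψ to b(q+1) - b(q). So the
partial sums A at ψ and ψ+χ differ by at most b(N); as χ generates ℤ/n, any two differ by at most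
n·b(N), which is negligible against the total. -/
theorem tendsto_sum_div_sum {n : ℕ} [NeZero n] {c : ℕ → ZMod n → ℝ} {b : ℕ → ℝ} {χ : ZMod n}
    (hχ : IsUnit χ) (hc : ∀ q ψ, 0 ≤ c q ψ) (hsum : ∀ q, ∑ ψ, c q ψ = b q)
    (hmono : ∀ q ψ, c q ψ ≤ c (q + 1) (ψ + χ)) (hb0 : 0 < b 0)
    (hb : Tendsto (fun N => b N / ∑ q ∈ Finset.range (N + 1), b q) atTop (𝓝 0)) (ψ : ZMod n) :
    Tendsto (fun N => (∑ q ∈ Finset.range (N + 1), c q ψ) / ∑ q ∈ Finset.range (N + 1), b q)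
      atTop (𝓝 (1 / n)) := by
  have hn : (0 : ℝ) < n := Nat.cast_pos.2 (NeZero.pos n)
  have hcb : ∀ q ψ, c q ψ ≤ b q := fun q ψ => by
    rw [← hsum]
    exact Finset.single_le_sum (fun ψ _ => hc q ψ) (Finset.mem_univ ψ)
  have hbnn : ∀ q, 0 ≤ b q := fun q => (hc q 0).trans (hcb q 0)
  have hdiff : ∀ q ψ, c (q + 1) (ψ + χ) - c q ψ ≤ b (q + 1) - b q := by
    intro q ψ
    have h1 : ∑ ψ, c (q + 1) (ψ + χ) = b (q + 1) := by
      rw [← hsum]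
      exact Fintype.sum_equiv (Equiv.addRight χ) _ _ fun _ => rfl
    rw [← h1, ← hsum q, ← Finset.sum_sub_distrib]
    exact Finset.single_le_sum (f := fun ψ => c (q + 1) (ψ + χ) - c q ψ)
      (fun ψ _ => sub_nonneg.2 (hmono q ψ)) (Finset.mem_univ ψ)
  let A : ℕ → ZMod n → ℝ := fun N ψ => ∑ q ∈ Finset.range (N + 1), c q ψ
  have hA : ∀ N ψ, A (N + 1) ψ = A N ψ + c (N + 1) ψ := fun N ψ => Finset.sum_range_succ _ _
  -- The expression is c(0, ψ+χ) plus the increments for q < N, so the upper bound telescopes.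
  have hshift : ∀ N ψ, 0 ≤ A N (ψ + χ) - A N ψ + c N ψ ∧
      A N (ψ + χ) - A N ψ + c N ψ ≤ b N := by
    intro N ψ
    induction N with
    | zero => simpa [A] using ⟨hc 0 (ψ + χ), hcb 0 (ψ + χ)⟩
    | succ N ih =>
      rw [hA, hA]
      have := hmono N ψ
      have := hdiff N ψ
      constructor <;> linarith [ih.1, ih.2]
  have hstep : ∀ N ψ, |A N (ψ + χ) - A N ψ| ≤ b N := by
    intro N ψ
    rw [abs_le]
    constructor <;> linarith [(hshift N ψ).1, (hshift N ψ).2, hc N ψ, hcb N ψ]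
  have hsteps : ∀ N ψ (j : ℕ), |A N (ψ + j * χ) - A N ψ| ≤ j * b N := by
    intro N ψ j
    induction j with
    | zero => simp
    | succ j ih =>
      have h1 := hstep N (ψ + j * χ)
      have h2 := abs_sub_le (A N (ψ + j * χ + χ)) (A N (ψ + j * χ)) (A N ψ)
      have h3 : ψ + ((j + 1 : ℕ) : ZMod n) * χ = ψ + j * χ + χ := by push_cast; ring
      rw [h3]
      push_cast
      linarith
  have hall : ∀ N ψ ψ', |A N ψ' - A N ψ| ≤ n * b N := by
    intro N ψ ψ'
    obtain ⟨w, hw⟩ := hχ.exists_left_inv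
    have h1 := hsteps N ψ ((ψ' - ψ) * w).val
    have h2 : ψ + (((ψ' - ψ) * w).val : ZMod n) * χ = ψ' := by
      rw [ZMod.natCast_val, ZMod.cast_id', id, mul_assoc, hw, mul_one, add_sub_cancel]
    rw [h2] at h1
    refine h1.trans (mul_le_mul_of_nonneg_right ?_ (hbnn N))
    exact_mod_cast (ZMod.val_lt _).le
  have htotal : ∀ N, ∑ ψ, A N ψ = ∑ q ∈ Finset.range (N + 1), b q := by
    intro N
    rw [Finset.sum_comm]
    exact Finset.sum_congr rfl fun q _ => hsum q
  have hpos : ∀ N, 0 < ∑ q ∈ Finset.range (N + 1), b q := fun N =>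
    hb0.trans_le (Finset.single_le_sum (f := b) (fun q _ => hbnn q) (by simp))
  have hbound : ∀ N, |A N ψ / (∑ q ∈ Finset.range (N + 1), b q) - 1 / n| ≤
      n * (b N / ∑ q ∈ Finset.range (N + 1), b q) := by
    intro N
    have h1 : |n * A N ψ - ∑ q ∈ Finset.range (N + 1), b q| ≤ n * (n * b N) := by
      rw [← htotal]
      have h2 : (n : ℝ) * A N ψ - ∑ ψ', A N ψ' = ∑ ψ', (A N ψ - A N ψ') := by
        rw [Finset.sum_sub_distrib]
        simp [ZMod.card]
      rw [h2]
      refine (Finset.abs_sum_le_sum_abs _ _).trans ?_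
      refine (Finset.sum_le_sum fun ψ' _ => hall N ψ' ψ).trans ?_
      simp [ZMod.card]
    have h3 : A N ψ / (∑ q ∈ Finset.range (N + 1), b q) - 1 / n =
        (n * A N ψ - ∑ q ∈ Finset.range (N + 1), b q) /
          (n * ∑ q ∈ Finset.range (N + 1), b q) := by
      have := (hpos N).ne'
      field_simp
    rw [h3, abs_div, abs_of_pos (mul_pos hn (hpos N)), div_le_iff₀ (mul_pos hn (hpos N))]
    refine h1.trans (le_of_eq ?_)
    have := (hpos N).ne'
    field_simp
  rw [tendsto_iff_dist_tendsto_zero]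
  refine squeeze_zero (fun N => dist_nonneg) (fun N => ?_) (by simpa using hb.const_mul (n : ℝ))
  rw [Real.dist_eq]
  exact hbound N

theorem tendsto_multichoose_div_sum {r : ℕ} (hr : 0 < r) :
    Tendsto (fun N : ℕ => (r.multichoose N : ℝ) /
      ∑ q ∈ Finset.range (N + 1), (r.multichoose q : ℝ)) atTop (𝓝 0) := by
  have hstep : ∀ N, (N + 1) * r.multichoose (N + 1) = (r + N) * r.multichoose N := by
    intro N
    obtain ⟨s, rfl⟩ : ∃ s, r = s + 1 := ⟨r - 1, by omega⟩
    rw [Nat.multichoose_eq, Nat.multichoose_eq]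
    have := Nat.add_one_mul_choose_eq (s + N) N
    rw [show s + 1 + (N + 1) - 1 = s + N + 1 by omega, show s + 1 + N - 1 = s + N by omega,
      show s + 1 + N = s + N + 1 by omega, this, mul_comm]
  -- A form of the hockey-stick identity; it makes the quotient exactly r/(r + N).
  have hsum : ∀ N, (r + N) * r.multichoose N = r * ∑ q ∈ Finset.range (N + 1), r.multichoose q := by
    intro N
    induction N with
    | zero => simp
    | succ N ih =>
      rw [Finset.sum_range_succ, mul_add, ← ih]
      linarith [hstep N]
  have heq : ∀ N : ℕ, (r.multichoose N : ℝ) / ∑ q ∈ Finset.range (N + 1), (r.multichoose q : ℝ) =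
      r / (r + N : ℕ) := by
    intro N
    have h1 : (0 : ℝ) < ∑ q ∈ Finset.range (N + 1), (r.multichoose q : ℝ) := by
      refine lt_of_lt_of_le one_pos ?_
      refine le_trans ?_ (Finset.single_le_sum (f := fun q => (r.multichoose q : ℝ))
        (fun q _ => Nat.cast_nonneg _) (a := 0) (by simp))
      simp
    have h2 : (0 : ℝ) < (r + N : ℕ) := by exact_mod_cast (by omega : 0 < r + N)
    rw [div_eq_div_iff h1.ne' h2.ne']
    have := congrArg (Nat.cast : ℕ → ℝ) (hsum N)
    push_cast at this ⊢
    linarith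
  simp only [heq]
  refine Tendsto.div_atTop tendsto_const_nhds ?_
  refine tendsto_natCast_atTop_atTop.comp ?_
  exact tendsto_atTop_mono (fun N => Nat.le_add_left N r) tendsto_id

/-- Adjoining the element t of unit weight to a multiset is injective and shifts the total weight by
χ(t). -/
theorem tendsto_card_sym_div_card_sym {n : ℕ} [NeZero n] {r : ℕ} {χ : Fin r → ZMod n}
    {t : Fin r} (ht : IsUnit (χ t)) (ψ : ZMod n) :
    Tendsto (fun N : ℕ => (∑ q ∈ Finset.range (N + 1),
        (Fintype.card {m : Sym (Fin r) q // ((m : Multiset (Fin r)).map χ).sum = ψ} : ℝ)) /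
      ∑ q ∈ Finset.range (N + 1), (Fintype.card (Sym (Fin r) q) : ℝ)) atTop (𝓝 (1 / n)) := by
  have hcard : ∀ q, Fintype.card (Sym (Fin r) q) = r.multichoose q := fun q => by
    rw [Sym.card_sym_eq_multichoose, Fintype.card_fin]
  refine tendsto_sum_div_sum (b := fun q => (Fintype.card (Sym (Fin r) q) : ℝ))
    (c := fun q ψ =>
      (Fintype.card {m : Sym (Fin r) q // ((m : Multiset (Fin r)).map χ).sum = ψ} : ℝ))
    ht (fun q ψ => Nat.cast_nonneg _) (fun q => ?_) (fun q ψ => ?_) ?_ ?_ ψ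
  · rw [← Nat.cast_sum, ← Fintype.card_sigma]
    exact congrArg _ (Fintype.card_congr (Equiv.sigmaFiberEquiv _))
  · refine Nat.cast_le.2 (Fintype.card_le_of_injective
      (fun m => ⟨t ::ₛ m.1, ?_⟩) fun m m' h => Subtype.ext ?_)
    · rw [Sym.coe_cons, Multiset.map_cons, Multiset.sum_cons, m.2, add_comm]
    · exact (Sym.cons_inj_right t _ _).1 (congrArg Subtype.val h)
  · simp
  · simp only [hcard]
    exact tendsto_multichoose_div_sum t.pos

end Counting

/-! ### The symmetric signature of cyclic quotient singularities -/

section Signature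

variable {k : Type u} [Field k] {n a : ℕ} [NeZero n]

theorem dim_weightRing [IsLocalRing (weightRing k n a)] : dim (weightRing k n a) = 2 := by
  rw [dim, ringKrullDim_weightRing]
  rfl

theorem exists_equiv_symSyz [IsLocalRing (weightRing k n a)] [IsDomain (weightRing k n a)]
    (ha : Nat.Coprime a n) :
    ∃ (r : ℕ) (χ : Fin r → ZMod n) (t : Fin r), IsUnit (χ t) ∧
      ∀ q, Nonempty (SymSyz (weightRing k n a) q ≃ₗ[weightRing k n a]
        ∀ m : Sym (Fin r) q, weightPart k n a ((m : Multiset (Fin r)).map χ).sum) := by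
  obtain ⟨r, χ, ⟨e⟩, t, ht⟩ := exists_equiv_syzygy (k := k) ha
  refine ⟨r, χ, t, ht, fun q => ?_⟩
  unfold SymSyz
  rw [dim_weightRing]
  exact reflexiveSymmetricPower_equiv ha q e

theorem hasGeneralizedSymmetricSignature_weightRing [IsLocalRing (weightRing k n a)]
    [IsDomain (weightRing k n a)] (ha : Nat.Coprime a n) {M : Type v} [AddCommGroup M]
    [Module (weightRing k n a) M] (hM : IsMCM (weightRing k n a) M)
    (hM' : IsIndecomposable (weightRing k n a) M) :
    HasGeneralizedSymmetricSignature (weightRing k n a) M (1 / n) := by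
  obtain ⟨ψ, ⟨eM⟩⟩ := exists_equiv_weightPart_of_isMCM hM hM'
  obtain ⟨r, χ, t, ht, hX⟩ := exists_equiv_symSyz (k := k) ha
  refine ⟨fun q => Fintype.card {m : Sym (Fin r) q // ((m : Multiset (Fin r)).map χ).sum = ψ},
    fun q b => ?_, ?_⟩
  · obtain ⟨e⟩ := hX q
    exact isMultiplicity_iff ha eM e b
  · have hrank : ∀ q, rank (weightRing k n a) (SymSyz (weightRing k n a) q) =
        Fintype.card (Sym (Fin r) q) := fun q => by
      obtain ⟨e⟩ := hX q
      exact rank_eq e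
    simp only [hrank]
    exact tendsto_card_sym_div_card_sym ht ψ

theorem hasSymmetricSignature_weightRing [IsLocalRing (weightRing k n a)]
    [IsDomain (weightRing k n a)] (ha : Nat.Coprime a n) :
    HasSymmetricSignature (weightRing k n a) (1 / n) := by
  obtain ⟨r, χ, t, ht, hX⟩ := exists_equiv_symSyz (k := k) ha
  have hrank : ∀ q, rank (weightRing k n a) (SymSyz (weightRing k n a) q) =
      Fintype.card (Sym (Fin r) q) := fun q => by
    obtain ⟨e⟩ := hX q
    exact rank_eq e
  have hfree : ∀ q, freeRank (weightRing k n a) (SymSyz (weightRing k n a) q) =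
      Fintype.card {m : Sym (Fin r) q // ((m : Multiset (Fin r)).map χ).sum = 0} := fun q => by
    obtain ⟨e⟩ := hX q
    exact freeRank_eq ha e
  unfold HasSymmetricSignature
  simp only [hrank, hfree]
  exact tendsto_card_sym_div_card_sym ht 0

end Signature

/-! ### The cyclic group and its ring of invariants -/

section CyclicGroup

variable {k : Type u} [Field k]

/-- The diagonal matrices with entries `ξ`, `ξ ^ a` form a group. -/
def diagHom (a : ℕ) : kˣ →* GL (Fin 2) k where
  toFun ξ := diagGenerator ξ a
  map_one' := by
    ext i j
    fin_cases i <;> fin_cases j <;> simp [diagGenerator]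
  map_mul' ξ η := by
    ext i j
    fin_cases i <;> fin_cases j <;> simp [diagGenerator, mul_pow]

theorem diagHom_injective (a : ℕ) : Function.Injective (diagHom (k := k) a) := by
  intro ξ η h
  have := congrArg (fun g : GL (Fin 2) k => g 0 0) h
  ext
  simpa [diagHom, diagGenerator] using this

theorem card_cyclicGroup {ξ : kˣ} {n : ℕ} (hξ : IsPrimitiveRoot ξ n) (a : ℕ) :
    Nat.card (cyclicGroup ξ a) = n := by
  rw [cyclicGroup, Nat.card_zpowers, hξ.eq_orderOf]
  exact orderOf_injective (diagHom a) (diagHom_injective a) ξ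

theorem coeff_linearAction_diagGenerator (ξ : kˣ) (a : ℕ) (f : MvPowerSeries (Fin 2) k)
    (d : Fin 2 →₀ ℕ) :
    coeff d (linearAction (diagGenerator ξ a) f) = (ξ : k) ^ (d 0 + a * d 1) * coeff d f := by
  have h1 : linearAction (diagGenerator ξ a) f = rescale ![(ξ : k), (ξ : k) ^ a] f := by
    rw [rescale_eq_subst, linearAction, substAlgHom_apply]
    congr 1
    funext j
    fin_cases j <;> simp [diagGenerator, Fin.sum_univ_two]
  rw [h1, coeff_rescale, Finsupp.prod_fintype _ _ (fun i => pow_zero _), Fin.prod_univ_two]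
  simp [pow_add, pow_mul]

/-- The generator multiplies uⁱvʲ by ξ^(i+aj), which is 1 exactly when n divides i + aj, as ξ is
primitive. -/
theorem cyclicSingularity_eq_weightRing {ξ : kˣ} {n : ℕ} (hξ : IsPrimitiveRoot ξ n) (a : ℕ) :
    cyclicSingularity ξ a = weightRing k n a := by
  have hw : ∀ d : Fin 2 →₀ ℕ, weight n a d = 0 ↔ n ∣ d 0 + a * d 1 := fun d => by
    rw [weight_apply, ← ZMod.natCast_eq_zero_iff]
    push_cast
    rfl
  ext f
  constructor
  · intro hf d hd
    have h1 := congrArg (coeff d) (hf (diagGenerator ξ a) (Subgroup.mem_zpowers _))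
    rw [coeff_linearAction_diagGenerator] at h1
    rw [hw, ← hξ.pow_eq_one_iff_dvd]
    ext
    push_cast
    exact mul_right_cancel₀ hd (h1.trans (one_mul _).symm)
  · rintro hf g ⟨i, rfl⟩
    have hg : diagGenerator ξ a ^ i = diagGenerator (ξ ^ i) a := (map_zpow (diagHom a) ξ i).symm
    change linearAction (diagGenerator ξ a ^ i) f = f
    rw [hg]
    ext d
    rw [coeff_linearAction_diagGenerator]
    by_cases hd : coeff d f = 0
    · rw [hd, mul_zero]
    · have h1 : ξ ^ (d 0 + a * d 1) = 1 := (hξ.pow_eq_one_iff_dvd _).2 ((hw d).1 (hf d hd))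
      have h2 : (ξ ^ i) ^ (d 0 + a * d 1) = 1 := by
        rw [← zpow_natCast, zpow_comm, zpow_natCast, h1, one_zpow]
      rw [← Units.val_pow_eq_pow_val, h2, Units.val_one, one_mul]

theorem signature_of_eq_weightRing {n a : ℕ} [NeZero n]
    (ha : Nat.Coprime a n) {A : Subalgebra k (MvPowerSeries (Fin 2) k)}
    (hA : A = weightRing k n a) [IsDomain A] [IsLocalRing A] :
    (∀ (M : Type v) [AddCommGroup M] [Module A M], IsMCM A M → IsIndecomposable A M →
      HasGeneralizedSymmetricSignature A M (1 / n)) ∧ HasSymmetricSignature A (1 / n) := by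
  subst hA
  exact ⟨fun M _ _ hM hM' => hasGeneralizedSymmetricSignature_weightRing ha hM hM',
    hasSymmetricSignature_weightRing ha⟩

end CyclicGroup

end SymmetricSignature

end

theorem theorem4p5p6 {k : Type u} [Field k] [IsAlgClosed k] (n a : ℕ)
    (hchar : ¬ ringChar k ∣ n) (ha : Nat.Coprime a n) (ξ : kˣ) (hξ : IsPrimitiveRoot ξ n) :
    (∀ (M : Type v) [AddCommGroup M] [Module (SymmetricSignature.cyclicSingularity ξ a) M],
        SymmetricSignature.IsMCM (SymmetricSignature.cyclicSingularity ξ a) M →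
        SymmetricSignature.IsIndecomposable (SymmetricSignature.cyclicSingularity ξ a) M →
        SymmetricSignature.HasGeneralizedSymmetricSignature
          (SymmetricSignature.cyclicSingularity ξ a) M
          (1 / (Nat.card (SymmetricSignature.cyclicGroup ξ a) : ℝ))) ∧
    SymmetricSignature.HasSymmetricSignature (SymmetricSignature.cyclicSingularity ξ a)
      (1 / (Nat.card (SymmetricSignature.cyclicGroup ξ a) : ℝ)) := by
  have : NeZero n := ⟨by rintro rfl; exact hchar (dvd_zero _)⟩
  rw [SymmetricSignature.card_cyclicGroup hξ a]
  exact SymmetricSignature.signature_of_eq_weightRing ha (SymmetricSignature.cyclicSingularity_eq_weightRing hξ a)
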